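/- **Setting.** Identify $\mathbb R^{n\times n}$ with $\mathbb R^{n^2}$ with its Euclidean (Frobenius) norm $\|\cdot\|_F$. For a finitely supported function $\mu:\mathbb R^{2n}\to\mathbb R$ and a polynomial $f$ in the $2n$ variables $(u,v)$ write $\tilde{\mathbb E}_\mu f=\sum_{x}\mu(x)f(x)$. Call $\mu$ a degree-$d$ pseudo-distribution if $\tilde{\mathbb E}_\mu 1=1$ and $\tilde{\mathbb E}_\mu f^2\ge 0$ whenever $2\deg f\le d$. It satisfies $\{q=0\}$ if $\tilde{\mathbb E}_\mu qf=0$ whenever $\deg q+\deg f\le d$. It satisfies $uv^\top\in\mathcal W$ if it satisfies $\{\langle A,uv^\top\rangle=0\}$ for every $A\in\mathcal W^\perp$. A degree-$k$ reweighting of $\mu$ is a function $\mu'=p\cdot\mu$, where $p$ is a sum-of-squares polynomial with $\deg p\le k$ and $\tilde{\mathbb E}_{\mu}p=1$. For $C\in\mathbb N$ put $$k=k_C(n,\varepsilon)=\left\lceil \frac{\sqrt n\,\bigl(\log(n+2)\bigr)^C}{\min(\varepsilon,1)^2}\right\rceil .$$ **Algorithm.** Input: a basis of a subspace $\mathcal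 W\subseteq\mathbb R^{n^2}$ and $\varepsilon>0$. 1. Run a sum-of-squares solver to obtain a degree-$(k+2)$ pseudo-distribution $\mu$ satisfying $\|u\|^2=1$, $\|v\|^2=1$ and $uv^\top\in\mathcal W$. If there is none, output FAIL. 2. Apply to $(n,\varepsilon,\mu)$ a reweighting procedure, which returns the polynomial $p$ of a degree-$k$ reweighting $\mu'=p\cdot\mu$. Put $u_0=\tilde{\mathbb E}_{\mu'}u$ and $v_0=\tilde{\mathbb E}_{\mu'}v$. 3. Output $u_0v_0^\top$. A solver is correct if, on every set of polynomial equality constraints and every degree, it returns a pseudo-distribution of that degree satisfying the constraints when one exists, and reports that there is none otherwise. A reweighting procedure is correct (for $C$) if for all $n$, all $\varepsilon>0$ and every degree-$(k+2)$ pseudo-distribution $\mu$ satisfying $\|u\|^2=1$ and $\|v\|^2=1$, it returns the polynomial of a degree-$k$ reweighting $\mu'$ with $$u_0v_0^\top\ne0,\qquad \bigl\|\tilde{\mathbb E}_{\mu'}uv^\top-u_0v_0^\top\bigr\|_F\le\varepsilon\,\|u_0v_0^\top\|_F .$$ **Theorem 4.2 (Analysis of algorithm).** There are an absolute constant $C\ge1$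 and a correct reweighting procedure for $C$ such that the following holds for every correct solver. Let $\varepsilon>0$ and let $\mathcal W\subseteq\mathbb R^{n^2}$ be a linear subspace containing a nonzero rank-one matrix $uv^\top$. Then, on input any basis of $\mathcal W$ and $\varepsilon$, the algorithm does not fail, and outputs a nonzero rank-one matrix $L$ with $$\|\Pi_{\mathcal W}L\|_F^2\ge(1-\varepsilon^2)\,\|L\|_F^2,$$ where $\Pi_{\mathcal W}$ is the orthogonal projector onto $\mathcal W$. -/

import Mathlib

open scoped BigOperators

/-! Pseudo-distributions -/

/-- Finitely supported real-valued (signed) functions on `ℝ^σ`. -/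
abbrev SignedFn (σ : Type) : Type := (σ → ℝ) →₀ ℝ

/-- The pseudo-expectation `∑_{x ∈ supp μ} μ(x) f(x)` of a polynomial `f`. -/
noncomputable def pexp {σ : Type} (μ : SignedFn σ) (f : MvPolynomial σ ℝ) : ℝ :=
  ∑ x ∈ μ.support, μ x * MvPolynomial.eval x f

/-- `μ` is a degree-`d` pseudo-distribution over `ℝ^σ`. -/
structure IsPseudoDistribution {σ : Type} (d : ℕ) (μ : SignedFn σ) : Prop where
  pexp_one : pexp μ 1 = 1
  pexp_sq_nonneg : ∀ f : MvPolynomial σ ℝ, 2 * f.totalDegree ≤ d → 0 ≤ pexp μ (f ^ 2)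

/-- The degree-`d` pseudo-distribution `μ` satisfies the constraint `{q = 0}`:
the pseudo-expectation of `q f` vanishes whenever `deg q + deg f ≤ d`. -/
def SatisfiesEq {σ : Type} (d : ℕ) (μ : SignedFn σ) (q : MvPolynomial σ ℝ) : Prop :=
  ∀ f : MvPolynomial σ ℝ, q.totalDegree + f.totalDegree ≤ d → pexp μ (q * f) = 0

/-- `μ` is a degree-`d` pseudo-distribution satisfying all constraints `{q = 0}`, `q ∈ E`. -/
def IsFeasible {σ : Type} (E : Set (MvPolynomial σ ℝ)) (d : ℕ) (μ : SignedFn σ) : Prop :=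
  IsPseudoDistribution d μ ∧ ∀ q ∈ E, SatisfiesEq d μ q

/-- The pointwise product `p · μ`. -/
noncomputable def reweight {σ : Type} (p : MvPolynomial σ ℝ) (μ : SignedFn σ) : SignedFn σ :=
  Finsupp.onFinset μ.support (fun x => MvPolynomial.eval x p * μ x) (by
    intro x hx
    exact Finsupp.mem_support_iff.mpr (right_ne_zero_of_mul hx))

/-- `p` is the polynomial of a degree-`k` reweighting `p · μ` of `μ`: a sum of squares of degree
at most `k`, normalized so that `p · μ` has total mass one. -/
structure IsReweightingPoly {σ : Type} (k : ℕ) (μ : SignedFn σ) (p : MvPolynomial σ ℝ) :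
    Prop where
  isSumSq : IsSumSq p
  degree_le : p.totalDegree ≤ k
  mass_one : pexp (reweight p μ) 1 = 1

/-! Pairs of vectors `(u, v) ∈ ℝ^{2n}`, and matrices as vectors in `ℝ^{n²}` -/

/-- Index set of the coordinates of `(u, v)`. -/
abbrev PairVar (n : ℕ) : Type := Fin n ⊕ Fin n

/-- The polynomial `u_i`. -/
noncomputable def uVar {n : ℕ} (i : Fin n) : MvPolynomial (PairVar n) ℝ :=
  MvPolynomial.X (Sum.inl i)

/-- The polynomial `v_j`. -/
noncomputable def vVar {n : ℕ} (j : Fin n) : MvPolynomial (PairVar n) ℝ :=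
  MvPolynomial.X (Sum.inr j)

/-- The constraints `‖u‖² = 1` and `‖v‖² = 1`. -/
def sphereConstraints (n : ℕ) : Set (MvPolynomial (PairVar n) ℝ) :=
  {(∑ i : Fin n, uVar i ^ 2) - 1, (∑ j : Fin n, vVar j ^ 2) - 1}

/-- `ℝ^{n²}` with coordinates indexed by `[n] × [n]`; its norm is the Frobenius norm. -/
abbrev MatSpace (n : ℕ) : Type := EuclideanSpace ℝ (Fin n × Fin n)

/-- A matrix as a vector of `ℝ^{n²}`. -/
def toVec {n : ℕ} (L : Matrix (Fin n) (Fin n) ℝ) : MatSpace n :=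
  WithLp.toLp 2 (fun ij => L ij.1 ij.2)

/-- The constraint `u vᵀ ∈ W`, that is `⟨A, u vᵀ⟩ = 0` for every `A` orthogonal to `W`. -/
def subspaceConstraints {n : ℕ} (W : Submodule ℝ (MatSpace n)) :
    Set (MvPolynomial (PairVar n) ℝ) :=
  {q | ∃ A ∈ Wᗮ, q = ∑ i : Fin n, ∑ j : Fin n, MvPolynomial.C (A (i, j)) * (uVar i * vVar j)}

/-- The vector `u₀`, the pseudo-expectation of `u`. -/
noncomputable def meanU {n : ℕ} (μ : SignedFn (PairVar n)) : Fin n → ℝ :=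
  fun i => pexp μ (uVar i)

/-- The vector `v₀`, the pseudo-expectation of `v`. -/
noncomputable def meanV {n : ℕ} (μ : SignedFn (PairVar n)) : Fin n → ℝ :=
  fun j => pexp μ (vVar j)

/-- The matrix which is the pseudo-expectation of `u vᵀ`. -/
noncomputable def meanUV {n : ℕ} (μ : SignedFn (PairVar n)) : Matrix (Fin n) (Fin n) ℝ :=
  Matrix.of fun i j => pexp μ (uVar i * vVar j)

/-! The algorithm -/

/-- The degree parameter `k = √n · log^C n / ε²`, rounded up. The argument of the logarithm is
shifted, and `ε` is capped at `1`, so that `k` does not degenerate for `n ≤ 2` or for large `ε`. -/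
noncomputable def degreeParam (C n : ℕ) (ε : ℝ) : ℕ :=
  ⌈Real.sqrt n * Real.log (n + 2) ^ C / (min ε 1) ^ 2⌉₊

/-- A subroutine for the sum-of-squares feasibility problem: on a set of equality constraints in
`(u, v)` and a degree, it returns a function on `ℝ^{2n}` or reports that there is none. -/
abbrev SosSolver : Type :=
  ∀ n : ℕ, Set (MvPolynomial (PairVar n) ℝ) → ℕ → Option (SignedFn (PairVar n))

/-- The solver returns a feasible pseudo-distribution exactly when there is one; which one it
returns is left open. -/
def SosSolver.Correct (sos : SosSolver) : Prop :=
  ∀ (n : ℕ) (E : Set (MvPolynomial (PairVar n) ℝ)) (d : ℕ),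
    (∀ μ, sos n E d = some μ → IsFeasible E d μ) ∧
    (sos n E d = none → ¬ ∃ μ, IsFeasible E d μ)

theorem SosSolver.exists_correct : ∃ sos : SosSolver, sos.Correct := by
  classical
  refine ⟨fun n E d => if h : ∃ μ, IsFeasible E d μ then some h.choose else none, ?_⟩
  intro n E d
  dsimp only
  split
  · rename_i h
    exact ⟨fun μ hμ => (Option.some.inj hμ) ▸ h.choose_spec, fun hn => nomatch hn⟩
  · rename_i h
    exact ⟨fun μ hμ => (nomatch hμ), fun _ => h⟩

/-- A reweighting subroutine: from `ε` and a pseudo-distribution (and nothing else) it computes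
a reweighting polynomial. -/
abbrev ReweightingProcedure : Type :=
  ∀ n : ℕ, ℝ → SignedFn (PairVar n) → MvPolynomial (PairVar n) ℝ

/-- For every `ε > 0` and every degree-`(k+2)` pseudo-distribution `μ` over pairs of unit vectors,
the procedure finds a degree-`k` reweighting `μ'` of `μ` with `u₀ v₀ᵀ ≠ 0` and
`‖Ẽ u vᵀ - u₀ v₀ᵀ‖_F ≤ ε ‖u₀ v₀ᵀ‖_F`. -/
def ReweightingProcedure.Correct (C : ℕ) (proc : ReweightingProcedure) : Prop :=
  ∀ (n : ℕ) (ε : ℝ) (μ : SignedFn (PairVar n)), 0 < ε →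
    IsFeasible (sphereConstraints n) (degreeParam C n ε + 2) μ →
    IsReweightingPoly (degreeParam C n ε) μ (proc n ε μ) ∧
    Matrix.vecMulVec (meanU (reweight (proc n ε μ) μ)) (meanV (reweight (proc n ε μ) μ)) ≠ 0 ∧
    ‖toVec (meanUV (reweight (proc n ε μ) μ) -
        Matrix.vecMulVec (meanU (reweight (proc n ε μ) μ)) (meanV (reweight (proc n ε μ) μ)))‖ ≤
      ε * ‖toVec
        (Matrix.vecMulVec (meanU (reweight (proc n ε μ) μ)) (meanV (reweight (proc n ε μ) μ)))‖

/-- The rank-one rounding algorithm on input the vectors `b` spanning the subspace, and `ε`.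
The value `none` is the answer `FAIL`. -/
noncomputable def roundingAlgorithm (C : ℕ) (sos : SosSolver) (proc : ReweightingProcedure)
    {n m : ℕ} (b : Fin m → MatSpace n) (ε : ℝ) : Option (Matrix (Fin n) (Fin n) ℝ) :=
  match sos n (subspaceConstraints (Submodule.span ℝ (Set.range b)) ∪ sphereConstraints n)
      (degreeParam C n ε + 2) with
  | none => none
  | some μ =>
      let μ' := reweight (proc n ε μ) μ
      some (Matrix.vecMulVec (meanU μ') (meanV μ'))

/-! The constraint `u vᵀ ∈ W` survives reweighting in expectation, so `Ẽ u vᵀ` lies in `W`. If `u₀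
v₀ᵀ` is `ε`-close to it, Pythagoras bounds the part of `u₀ v₀ᵀ` orthogonal to `W`
(`norm_starProjection_sq_ge`). Feasibility comes from a point mass (`exists_isFeasible`). The
content is the existence of the reweighting.

Let `M(a, b)` be the maximum over unit vectors `w`, `z` of `Ẽ ⟨u,w⟩^(2a) ⟨v,z⟩^(2b)`. Cauchy–Schwarz
makes `log M` midpoint convex, and `‖u‖ = ‖v‖ = 1` makes it decreasing. The second-order condition
at a maximizer, summed over the directions orthogonal to `w`, shows that passing from `a + 1` to `a
+ 2` loses at most a factor `(n + 2a)/(2a + 1) ≤ n` (`maxMoment_le_succ`). A convex function with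
slopes in `[-log n, 0]` is nearly affine somewhere: for some exponents of order `J`, `M(a+i, b+j)`
is at most about `N A^i B^j`, exactly so at the centre, with `A ≥ J/(n+J)`
(`exists_geometric_maxMoment`).

Near equality in Cauchy–Schwarz means that `⟨u,w⟩²` and `⟨v,z⟩²` concentrate at `A` and `B`. Linear
factors `x + α`, `y + β` in the weight select the signs, and the second-order condition in `z` makes
`v` of size `O(B/J)` in mean square along unit vectors orthogonal to `z`
(`exists_concentrated_weight`).

Then `‖u₀‖² ≥ A/4` and `‖v₀‖² ≥ B/4`, while `v` has variance `O(B (1 + log n)/J)` in every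
direction. Since `‖u‖ = 1`, that same quantity bounds the squared Frobenius norm of the covariance,
with no dimension factor (`sum_covariance_sq_le`). It remains to have `(1 + log n)/J` small compared
with `ε² J/(n+J)`, which holds for `J` of order `√n log n / ε²`. -/

open MvPolynomial

/-! ### Calculus of pseudo-expectations, degrees and linear forms. -/

section PseudoExpectation

variable {σ : Type} (μ : SignedFn σ)

theorem pexp_add (f g : MvPolynomial σ ℝ) : pexp μ (f + g) = pexp μ f + pexp μ g := by
  simp [pexp, mul_add, Finset.sum_add_distrib]

theorem pexp_C_mul (c : ℝ) (f : MvPolynomial σ ℝ) : pexp μ (C c * f) = c * pexp μ f := by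
  simp only [pexp, map_mul, eval_C, Finset.mul_sum]
  exact Finset.sum_congr rfl fun x _ => by ring

theorem pexp_neg (f : MvPolynomial σ ℝ) : pexp μ (-f) = -pexp μ f := by
  simp [pexp, Finset.sum_neg_distrib]

theorem pexp_sub (f g : MvPolynomial σ ℝ) : pexp μ (f - g) = pexp μ f - pexp μ g := by
  rw [sub_eq_add_neg, pexp_add, pexp_neg, sub_eq_add_neg]

theorem pexp_zero : pexp μ 0 = 0 := by simp [pexp]

theorem pexp_sum {ι : Type*} (s : Finset ι) (f : ι → MvPolynomial σ ℝ) :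
    pexp μ (∑ i ∈ s, f i) = ∑ i ∈ s, pexp μ (f i) := by
  simp only [pexp, map_sum, Finset.mul_sum]
  exact Finset.sum_comm

theorem pexp_reweight (p f : MvPolynomial σ ℝ) : pexp (reweight p μ) f = pexp μ (p * f) := by
  unfold pexp
  have hsub : (reweight p μ).support ⊆ μ.support := Finsupp.support_onFinset_subset
  rw [Finset.sum_subset hsub]
  · refine Finset.sum_congr rfl fun x _ => ?_
    simp only [reweight, Finsupp.onFinset_apply, map_mul]
    ring
  · intro x _ hx
    rw [Finsupp.notMem_support_iff.mp hx, zero_mul]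

/-- Cauchy–Schwarz for pseudo-expectations. -/
theorem pexp_mul_sq_le {d : ℕ}
    (hμ : ∀ f : MvPolynomial σ ℝ, 2 * f.totalDegree ≤ d → 0 ≤ pexp μ (f ^ 2))
    {f g : MvPolynomial σ ℝ} (hf : 2 * f.totalDegree ≤ d) (hg : 2 * g.totalDegree ≤ d) :
    pexp μ (f * g) ^ 2 ≤ pexp μ (f ^ 2) * pexp μ (g ^ 2) := by
  have key : ∀ t : ℝ, 0 ≤ pexp μ (f ^ 2) * (t * t) + (2 * pexp μ (f * g)) * t + pexp μ (g ^ 2) := by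
    intro t
    have h := hμ (C t * f + g) (by
      have h1 := totalDegree_add (C t * f) g
      have h2 := totalDegree_mul (C t) f
      rw [totalDegree_C, zero_add] at h2
      rcases max_cases (C t * f).totalDegree g.totalDegree with h | h <;> omega)
    have e : (C t * f + g) ^ 2 = C (t * t) * f ^ 2 + C (2 * t) * (f * g) + g ^ 2 := by
      simp only [map_mul, map_ofNat]; ring
    rw [e, pexp_add, pexp_add, pexp_C_mul, pexp_C_mul] at h
    linarith
  have := discrim_le_zero key
  unfold discrim at this
  nlinarith

end PseudoExpectation

section Degree

variable {σ : Type} {f g : MvPolynomial σ ℝ} {a b : ℕ}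

theorem totalDegree_mul_le_of_le (hf : f.totalDegree ≤ a) (hg : g.totalDegree ≤ b) :
    (f * g).totalDegree ≤ a + b :=
  (totalDegree_mul f g).trans (add_le_add hf hg)

theorem totalDegree_pow_le_of_le (hf : f.totalDegree ≤ 1) (m : ℕ) :
    (f ^ m).totalDegree ≤ m :=
  (totalDegree_pow f m).trans (by nlinarith)

theorem totalDegree_add_le_of_le (hf : f.totalDegree ≤ a) (hg : g.totalDegree ≤ a) :
    (f + g).totalDegree ≤ a :=
  (totalDegree_add f g).trans (max_le hf hg)

theorem totalDegree_sub_le_of_le (hf : f.totalDegree ≤ a) (hg : g.totalDegree ≤ a) :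
    (f - g).totalDegree ≤ a :=
  (totalDegree_sub f g).trans (max_le hf hg)

theorem totalDegree_C_le (c : ℝ) (a : ℕ) : (C c : MvPolynomial σ ℝ).totalDegree ≤ a := by
  simp

end Degree

section LinForm

variable {σ : Type} {n : ℕ}

/-- The linear combination of the polynomials `U i` with coefficients `w i`. -/
noncomputable def linForm (U : Fin n → MvPolynomial σ ℝ) (w : Fin n → ℝ) : MvPolynomial σ ℝ :=
  ∑ i, C (w i) * U i

theorem eval_linForm (U : Fin n → MvPolynomial σ ℝ) (w : Fin n → ℝ) (x : σ → ℝ) :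
    eval x (linForm U w) = ∑ i, w i * eval x (U i) := by
  simp [linForm, map_sum]

theorem linForm_add (U : Fin n → MvPolynomial σ ℝ) (w e : Fin n → ℝ) :
    linForm U (w + e) = linForm U w + linForm U e := by
  simp [linForm, add_mul, Finset.sum_add_distrib]

theorem linForm_smul (U : Fin n → MvPolynomial σ ℝ) (c : ℝ) (w : Fin n → ℝ) :
    linForm U (c • w) = C c * linForm U w := by
  simp [linForm, Finset.mul_sum, mul_assoc]

theorem linForm_single (U : Fin n → MvPolynomial σ ℝ) (i : Fin n) :
    linForm U (Pi.single i 1) = U i := by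
  simp only [linForm]
  rw [Finset.sum_eq_single i] <;> simp +contextual

theorem totalDegree_linForm {U : Fin n → MvPolynomial σ ℝ} (hU : ∀ i, (U i).totalDegree ≤ 1)
    (w : Fin n → ℝ) : (linForm U w).totalDegree ≤ 1 :=
  totalDegree_finsetSum_le fun i _ => by
    simpa using totalDegree_mul_le_of_le (totalDegree_C_le (w i) 0) (hU i)

end LinForm

/-! ### Second-order optimality on the sphere. -/

/-- The second-order necessary condition for a maximum at the origin. -/
theorem second_deriv_nonpos_of_max {g g₁ : ℝ → ℝ} {g₂ : ℝ} (h₁ : ∀ t, HasDerivAt g (g₁ t) t)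
    (h₂ : HasDerivAt g₁ g₂ 0) (hmax : ∀ t, g t ≤ g 0) : g₂ ≤ 0 := by
  by_contra! hpos
  have hd : deriv g = g₁ := funext fun t => (h₁ t).deriv
  have hlm : IsLocalMax g 0 := Filter.Eventually.of_forall hmax
  -- With a positive second derivative the maximum would also be a local minimum, so `g` would be
  -- locally constant and its second derivative zero.
  have hmin : IsLocalMin g 0 := by
    apply isLocalMin_of_deriv_deriv_pos
    · rw [hd, h₂.deriv]; exact hpos
    · exact hlm.deriv_eq_zero
    · exact (h₁ 0).continuousAt
  have heq : g =ᶠ[nhds 0] fun _ => g 0 := by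
    filter_upwards [hmin] with t ht
    exact le_antisymm (hmax t) ht
  have h3 : deriv g =ᶠ[nhds 0] fun _ => 0 := by
    simpa using heq.deriv
  have h4 := h3.deriv_eq
  rw [hd, h₂.deriv] at h4
  simp at h4
  exact hpos.ne' h4

/-- The second-order condition for a maximum over the unit sphere of `∑ j, pexp μ (q j * y ^ k j)`,
where `y` is the linear form with coefficients `z`. -/
theorem sphere_second_order {σ : Type} {n : ℕ} (μ : SignedFn σ) (V : Fin n → MvPolynomial σ ℝ)
    (s : Finset ℕ) (k : ℕ → ℕ) (q : ℕ → MvPolynomial σ ℝ) {z e : Fin n → ℝ} (hz : ∑ i, z i ^ 2 = 1)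
    (hze : ∑ i, z i * e i = 0)
    (hmax : ∀ z' : Fin n → ℝ, ∑ i, z' i ^ 2 = 1 →
      ∑ j ∈ s, pexp μ (q j * linForm V z' ^ k j) ≤ ∑ j ∈ s, pexp μ (q j * linForm V z ^ k j)) :
    ∑ j ∈ s, (k j : ℝ) * ((k j - 1 : ℕ) : ℝ) *
        pexp μ (q j * linForm V z ^ (k j - 2) * linForm V e ^ 2) ≤
      (∑ i, e i ^ 2) * ∑ j ∈ s, (k j : ℝ) * pexp μ (q j * linForm V z ^ k j) := by
  rcases eq_or_ne (∑ i, e i ^ 2) 0 with h0 | h0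
  · have he : e = 0 := by
      funext i
      have := (Finset.sum_eq_zero_iff_of_nonneg (fun i _ => sq_nonneg (e i))).mp h0 i
        (Finset.mem_univ i)
      simpa using this
    subst he
    have : linForm V (0 : Fin n → ℝ) = 0 := by simp [linForm]
    simp [this, pexp_zero]
  set r : ℝ := Real.sqrt (∑ i, e i ^ 2) with hr
  have hr2 : r ^ 2 = ∑ i, e i ^ 2 := Real.sq_sqrt (Finset.sum_nonneg fun i _ => sq_nonneg _)
  have hr0 : r ≠ 0 := fun h => h0 (by rw [← hr2, h]; simp)
  let Y : (σ → ℝ) → ℝ := fun x => eval x (linForm V z)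
  let H : (σ → ℝ) → ℝ := fun x => eval x (linForm V e)
  -- The linear form along the great circle `cos(rt) z + (sin(rt)/r) e`, which has velocity `e` at
  -- `t = 0`.
  let ell : (σ → ℝ) → ℝ → ℝ := fun x t => Real.cos (r * t) * Y x + Real.sin (r * t) / r * H x
  let ell' : (σ → ℝ) → ℝ → ℝ := fun x t => -(r * Real.sin (r * t)) * Y x + Real.cos (r * t) * H x
  have hrt : ∀ t : ℝ, HasDerivAt (fun t : ℝ => r * t) r t := fun t => by
    simpa using (hasDerivAt_id t).const_mul r
  have hell : ∀ x t, HasDerivAt (ell x) (ell' x t) t := by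
    intro x t
    have h1 := ((hrt t).cos.mul_const (Y x)).add (((hrt t).sin.div_const r).mul_const (H x))
    refine h1.congr_deriv ?_
    simp only [ell']
    field_simp
  have hell' : ∀ x, HasDerivAt (ell' x) (-(r ^ 2 * Y x)) 0 := by
    intro x
    have h1 := (((hrt 0).sin.const_mul r).neg.mul_const (Y x)).add ((hrt 0).cos.mul_const (H x))
    refine h1.congr_deriv ?_
    simp only [mul_zero, Real.cos_zero, Real.sin_zero]
    ring
  let g : ℝ → ℝ := fun t => ∑ j ∈ s, ∑ x ∈ μ.support, μ x * eval x (q j) * ell x t ^ k j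
  let g₁ : ℝ → ℝ := fun t => ∑ j ∈ s, ∑ x ∈ μ.support,
    μ x * eval x (q j) * ((k j : ℝ) * ell x t ^ (k j - 1) * ell' x t)
  have hg : ∀ t, HasDerivAt g (g₁ t) t := fun t =>
    HasDerivAt.fun_sum fun j _ => HasDerivAt.fun_sum fun x _ => ((hell x t).pow (k j)).const_mul _
  have hg₁ := HasDerivAt.fun_sum (u := s) (x := (0 : ℝ)) fun j _ =>
    HasDerivAt.fun_sum (u := μ.support) fun x _ =>
      ((((hell x 0).pow (k j - 1)).const_mul (k j : ℝ)).mul (hell' x)).const_mul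
        (μ x * eval x (q j))
  have hpt : ∀ t j, ∑ x ∈ μ.support, μ x * eval x (q j) * ell x t ^ k j =
      pexp μ (q j * linForm V (Real.cos (r * t) • z + (Real.sin (r * t) / r) • e) ^ k j) := by
    intro t j
    refine Finset.sum_congr rfl fun x _ => ?_
    simp only [map_mul, map_pow, linForm_add, linForm_smul, map_add, eval_C, ell, Y, H]
    ring
  have hz0 : Real.cos (r * 0) • z + (Real.sin (r * 0) / r) • e = z := by simp
  have hle : ∀ t, g t ≤ g 0 := by
    intro t
    simp only [g, hpt, hz0]
    refine hmax _ ?_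
    have : ∀ i, (Real.cos (r * t) • z + (Real.sin (r * t) / r) • e) i ^ 2 =
        Real.cos (r * t) ^ 2 * z i ^ 2 + (Real.sin (r * t) / r) ^ 2 * e i ^ 2 +
          2 * Real.cos (r * t) * (Real.sin (r * t) / r) * (z i * e i) := by
      intro i; simp only [Pi.add_apply, Pi.smul_apply, smul_eq_mul]; ring
    simp only [this, Finset.sum_add_distrib, ← Finset.mul_sum, hz, hze, ← hr2]
    have := Real.cos_sq_add_sin_sq (r * t)
    field_simp
    rw [this]
    ring
  have hfin := second_deriv_nonpos_of_max hg hg₁ hle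
  have e0 : ∀ x, ell x 0 = Y x := fun x => by simp [ell]
  have e1 : ∀ x, ell' x 0 = H x := fun x => by simp [ell']
  rw [← sub_nonpos, Finset.mul_sum, ← Finset.sum_sub_distrib]
  refine le_trans (le_of_eq ?_) hfin
  refine Finset.sum_congr rfl fun j _ => ?_
  simp only [pexp, Finset.mul_sum, ← Finset.sum_sub_distrib, ← hr2]
  refine Finset.sum_congr rfl fun x _ => ?_
  simp only [map_mul, map_pow, e0, e1, Y, H, Pi.pow_apply]
  -- Truncated exponents do no harm: for `k j ≤ 1` the coefficient `k j * (k j - 1)` vanishes.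
  rcases k j with _ | l
  · simp
  · simp only [Nat.add_sub_cancel, show l + 1 - 2 = l - 1 by omega]
    ring

/-! ### Maximal directional moments: monotonicity, log-convexity, positivity, growth. -/

/-- A degree-`d` pseudo-distribution with two families `U`, `V` of polynomials of degree at most
one whose squares sum up to one. -/
structure IsSpherePair {σ : Type} {n : ℕ} (d : ℕ) (μ : SignedFn σ)
    (U V : Fin n → MvPolynomial σ ℝ) : Prop where
  pexp_one : pexp μ 1 = 1
  sq_nonneg : ∀ f : MvPolynomial σ ℝ, 2 * f.totalDegree ≤ d → 0 ≤ pexp μ (f ^ 2)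
  degree_left : ∀ i, (U i).totalDegree ≤ 1
  degree_right : ∀ i, (V i).totalDegree ≤ 1
  norm_left : ∀ f : MvPolynomial σ ℝ, f.totalDegree + 2 ≤ d →
    pexp μ (f * ∑ i, U i ^ 2) = pexp μ f
  norm_right : ∀ f : MvPolynomial σ ℝ, f.totalDegree + 2 ≤ d →
    pexp μ (f * ∑ i, V i ^ 2) = pexp μ f

/-- The pseudo-expectation of `⟨u, w⟩ ^ (2 a) * ⟨v, z⟩ ^ (2 b)`. -/
noncomputable def pairMoment {σ : Type} {n : ℕ} (μ : SignedFn σ) (U V : Fin n → MvPolynomial σ ℝ)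
    (a b : ℕ) (w z : Fin n → ℝ) : ℝ :=
  pexp μ ((linForm U w ^ a * linForm V z ^ b) ^ 2)

/-- The maximum of `pairMoment` over pairs of unit vectors. -/
noncomputable def maxMoment {σ : Type} {n : ℕ} (μ : SignedFn σ) (U V : Fin n → MvPolynomial σ ℝ)
    (a b : ℕ) : ℝ :=
  sSup {r | ∃ w z : Fin n → ℝ, ∑ i, w i ^ 2 = 1 ∧ ∑ i, z i ^ 2 = 1 ∧ pairMoment μ U V a b w z = r}

section

variable {σ : Type} {n : ℕ} {μ : SignedFn σ} {U V : Fin n → MvPolynomial σ ℝ}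

theorem isCompact_unitVectors (n : ℕ) : IsCompact {w : Fin n → ℝ | ∑ i, w i ^ 2 = 1} := by
  refine Metric.isCompact_of_isClosed_isBounded (isClosed_eq (by fun_prop) (by fun_prop)) ?_
  refine (Metric.isBounded_closedBall (x := (0 : Fin n → ℝ)) (r := 1)).subset fun w hw => ?_
  rw [mem_closedBall_zero_iff, pi_norm_le_iff_of_nonneg zero_le_one]
  intro i
  rw [Real.norm_eq_abs, ← sq_le_one_iff_abs_le_one]
  have hw' : ∑ i, w i ^ 2 = 1 := hw
  rw [← hw']
  exact Finset.single_le_sum (fun i _ => sq_nonneg (w i)) (Finset.mem_univ i)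

theorem sum_single_sq (i : Fin n) : ∑ j, (Pi.single i (1 : ℝ) : Fin n → ℝ) j ^ 2 = 1 := by
  rw [Finset.sum_eq_single i] <;> simp +contextual

/-- A continuous function attains its maximum over pairs of unit vectors. -/
theorem exists_max_unitPair (hn : 0 < n) {F : (Fin n → ℝ) → (Fin n → ℝ) → ℝ}
    (hF : Continuous fun p : (Fin n → ℝ) × (Fin n → ℝ) => F p.1 p.2) :
    ∃ w z : Fin n → ℝ, ∑ i, w i ^ 2 = 1 ∧ ∑ i, z i ^ 2 = 1 ∧
      ∀ w' z' : Fin n → ℝ, ∑ i, w' i ^ 2 = 1 → ∑ i, z' i ^ 2 = 1 → F w' z' ≤ F w z := by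
  obtain ⟨p, hp, hmax⟩ := ((isCompact_unitVectors n).prod (isCompact_unitVectors n)).exists_isMaxOn
    ⟨(Pi.single ⟨0, hn⟩ 1, Pi.single ⟨0, hn⟩ 1), sum_single_sq _, sum_single_sq _⟩ hF.continuousOn
  exact ⟨p.1, p.2, hp.1, hp.2, fun w' z' hw' hz' => hmax (Set.mk_mem_prod hw' hz')⟩

theorem continuous_pairMoment (a b : ℕ) :
    Continuous fun p : (Fin n → ℝ) × (Fin n → ℝ) => pairMoment μ U V a b p.1 p.2 := by
  simp only [pairMoment, pexp, map_mul, map_pow, eval_linForm]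
  fun_prop

theorem pairMoment_swap (a b : ℕ) (w z : Fin n → ℝ) :
    pairMoment μ V U b a z w = pairMoment μ U V a b w z := by
  unfold pairMoment; rw [mul_comm]

theorem maxMoment_swap (a b : ℕ) : maxMoment μ V U b a = maxMoment μ U V a b := by
  unfold maxMoment
  congr 1
  ext r
  constructor
  · rintro ⟨w, z, hw, hz, h⟩
    exact ⟨z, w, hz, hw, by rw [← pairMoment_swap]; exact h⟩
  · rintro ⟨w, z, hw, hz, h⟩
    exact ⟨z, w, hz, hw, by rw [pairMoment_swap]; exact h⟩

theorem isGreatest_maxMoment (hn : 0 < n) (a b : ℕ) :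
    IsGreatest {r | ∃ w z : Fin n → ℝ, ∑ i, w i ^ 2 = 1 ∧ ∑ i, z i ^ 2 = 1 ∧
      pairMoment μ U V a b w z = r} (maxMoment μ U V a b) := by
  obtain ⟨w, z, hw, hz, hmax⟩ := exists_max_unitPair hn (continuous_pairMoment (μ := μ) (U := U)
    (V := V) a b)
  have hg : IsGreatest {r | ∃ w z : Fin n → ℝ, ∑ i, w i ^ 2 = 1 ∧ ∑ i, z i ^ 2 = 1 ∧
      pairMoment μ U V a b w z = r} (pairMoment μ U V a b w z) := by
    refine ⟨⟨w, z, hw, hz, rfl⟩, ?_⟩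
    rintro r ⟨w', z', hw', hz', rfl⟩
    exact hmax w' z' hw' hz'
  have : maxMoment μ U V a b = pairMoment μ U V a b w z := hg.csSup_eq
  rwa [this]

theorem exists_pairMoment_eq_maxMoment (hn : 0 < n) (a b : ℕ) :
    ∃ w z : Fin n → ℝ, ∑ i, w i ^ 2 = 1 ∧ ∑ i, z i ^ 2 = 1 ∧
      pairMoment μ U V a b w z = maxMoment μ U V a b :=
  (isGreatest_maxMoment hn a b).1

theorem pairMoment_le_maxMoment (hn : 0 < n) (a b : ℕ) {w z : Fin n → ℝ}
    (hw : ∑ i, w i ^ 2 = 1) (hz : ∑ i, z i ^ 2 = 1) :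
    pairMoment μ U V a b w z ≤ maxMoment μ U V a b :=
  (isGreatest_maxMoment hn a b).2 ⟨w, z, hw, hz, rfl⟩

/-- The vectors `e_i - w_i w` are the projections of the standard basis to the complement of `w`.
Summing an inequality over them amounts to taking a trace over that complement. -/
theorem linForm_residual (U : Fin n → MvPolynomial σ ℝ) (w : Fin n → ℝ) (i : Fin n) :
    linForm U (Pi.single i 1 + (-w i) • w) = U i - C (w i) * linForm U w := by
  rw [linForm_add, linForm_smul, linForm_single, C_neg]; ring

theorem sum_linForm_residual_sq (U : Fin n → MvPolynomial σ ℝ) {w : Fin n → ℝ}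
    (hw : ∑ i, w i ^ 2 = 1) :
    ∑ i, linForm U (Pi.single i 1 + (-w i) • w) ^ 2 = ∑ i, U i ^ 2 - linForm U w ^ 2 := by
  have h1 : ∀ i, linForm U (Pi.single i 1 + (-w i) • w) ^ 2 =
      U i ^ 2 - 2 * linForm U w * (C (w i) * U i) + linForm U w ^ 2 * C (w i ^ 2) := by
    intro i
    rw [linForm_residual, C_pow]; ring
  simp only [h1, Finset.sum_add_distrib, Finset.sum_sub_distrib, ← Finset.mul_sum, ← map_sum, hw,
    map_one]
  have : ∑ i, C (w i) * U i = linForm U w := rfl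
  rw [this]; ring

theorem sum_residual_mul {w : Fin n → ℝ} (hw : ∑ i, w i ^ 2 = 1) (i : Fin n) :
    ∑ j, w j * (Pi.single i 1 + (-w i) • w : Fin n → ℝ) j = 0 := by
  have : ∀ j, w j * (Pi.single i 1 + (-w i) • w : Fin n → ℝ) j =
      w j * (Pi.single i 1 : Fin n → ℝ) j - w i * w j ^ 2 := by
    intro j; simp only [Pi.add_apply, Pi.smul_apply, smul_eq_mul]; ring
  simp only [this, Finset.sum_sub_distrib, ← Finset.mul_sum, hw]
  rw [Finset.sum_eq_single i] <;> simp +contextual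

theorem sum_residual_sq {w : Fin n → ℝ} (hw : ∑ i, w i ^ 2 = 1) (i : Fin n) :
    ∑ j, (Pi.single i 1 + (-w i) • w : Fin n → ℝ) j ^ 2 = 1 - w i ^ 2 := by
  have : ∀ j, (Pi.single i 1 + (-w i) • w : Fin n → ℝ) j ^ 2 =
      (Pi.single i 1 : Fin n → ℝ) j ^ 2 - 2 * w i * (w j * (Pi.single i 1 : Fin n → ℝ) j) +
        w i ^ 2 * w j ^ 2 := by
    intro j; simp only [Pi.add_apply, Pi.smul_apply, smul_eq_mul]; ring
  simp only [this, Finset.sum_add_distrib, Finset.sum_sub_distrib, ← Finset.mul_sum, hw,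
    sum_single_sq]
  rw [Finset.sum_eq_single i] <;> simp +contextual
  ring

end

namespace IsSpherePair

variable {σ : Type} {n d : ℕ} {μ : SignedFn σ} {U V : Fin n → MvPolynomial σ ℝ}

theorem symm (h : IsSpherePair d μ U V) : IsSpherePair d μ V U :=
  ⟨h.pexp_one, h.sq_nonneg, h.degree_right, h.degree_left, h.norm_right, h.norm_left⟩

theorem totalDegree_monomial (h : IsSpherePair d μ U V) (a b : ℕ) (w z : Fin n → ℝ) :
    (linForm U w ^ a * linForm V z ^ b).totalDegree ≤ a + b :=
  totalDegree_mul_le_of_le (totalDegree_pow_le_of_le (totalDegree_linForm h.degree_left w) a)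
    (totalDegree_pow_le_of_le (totalDegree_linForm h.degree_right z) b)

theorem pairMoment_nonneg (h : IsSpherePair d μ U V) {a b : ℕ} (hd : 2 * (a + b) ≤ d)
    (w z : Fin n → ℝ) : 0 ≤ pairMoment μ U V a b w z :=
  h.sq_nonneg _ (by have := h.totalDegree_monomial a b w z; omega)

/-- The difference `‖u‖² - ⟨u,w⟩²` is the sum of squares of the residual linear forms, hence a
certificate of low degree. -/
theorem pexp_mul_linForm_sq_le (h : IsSpherePair d μ U V) {f : MvPolynomial σ ℝ}
    (hf : 2 * (f.totalDegree + 1) ≤ d) {w : Fin n → ℝ} (hw : ∑ i, w i ^ 2 = 1) :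
    pexp μ ((linForm U w * f) ^ 2) ≤ pexp μ (f ^ 2) := by
  have hnn : 0 ≤ ∑ i, pexp μ ((linForm U (Pi.single i 1 + (-w i) • w) * f) ^ 2) :=
    Finset.sum_nonneg fun i _ => h.sq_nonneg _ (by
      have := totalDegree_mul_le_of_le (totalDegree_linForm h.degree_left
        (Pi.single i 1 + (-w i) • w)) (le_refl f.totalDegree)
      omega)
  have hnorm := h.norm_left (f ^ 2) (by have := totalDegree_pow f 2; omega)
  rw [← pexp_sum] at hnn
  simp only [mul_pow, ← Finset.sum_mul, sum_linForm_residual_sq U hw, sub_mul] at hnn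
  rw [pexp_sub, mul_comm, hnorm] at hnn
  rw [mul_pow]
  linarith

theorem maxMoment_succ_le (h : IsSpherePair d μ U V) (hn : 0 < n) {a b : ℕ}
    (hd : 2 * (a + b + 1) ≤ d) : maxMoment μ U V (a + 1) b ≤ maxMoment μ U V a b := by
  obtain ⟨w, z, hw, hz, he⟩ := exists_pairMoment_eq_maxMoment (μ := μ) (U := U) (V := V) hn (a + 1) b
  rw [← he]
  refine le_trans ?_ (pairMoment_le_maxMoment hn a b hw hz)
  have hle := h.pexp_mul_linForm_sq_le (f := linForm U w ^ a * linForm V z ^ b) (by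
    have := h.totalDegree_monomial a b w z; omega) hw
  unfold pairMoment
  rwa [pow_succ' (linForm U w), mul_assoc (linForm U w)]

/-- Cauchy–Schwarz in fixed directions. The exponents `a₁`, `a₂` need not be even, only their sum.
-/
theorem pairMoment_sq_le (h : IsSpherePair d μ U V) {a b a₁ b₁ a₂ b₂ : ℕ}
    (ha : a₁ + a₂ = 2 * a) (hb : b₁ + b₂ = 2 * b) (h₁ : 2 * (a₁ + b₁) ≤ d)
    (h₂ : 2 * (a₂ + b₂) ≤ d) (w z : Fin n → ℝ) :
    pairMoment μ U V a b w z ^ 2 ≤ pairMoment μ U V a₁ b₁ w z * pairMoment μ U V a₂ b₂ w z := by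
  have hcs := pexp_mul_sq_le μ h.sq_nonneg (f := linForm U w ^ a₁ * linForm V z ^ b₁)
    (g := linForm U w ^ a₂ * linForm V z ^ b₂)
    (by have := h.totalDegree_monomial a₁ b₁ w z; omega)
    (by have := h.totalDegree_monomial a₂ b₂ w z; omega)
  unfold pairMoment
  convert hcs using 3
  rw [mul_mul_mul_comm, ← pow_add, ← pow_add, ha, hb]
  ring

end IsSpherePair

namespace IsSpherePair

variable {σ : Type} {n d : ℕ} {μ : SignedFn σ} {U V : Fin n → MvPolynomial σ ℝ}

/-- Cauchy–Schwarz is applied at a maximizer of the middle moment; the outer moments there are at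
most their own maxima. -/
theorem maxMoment_mid_sq_le (h : IsSpherePair d μ U V) (hn : 0 < n) {a b a₁ b₁ a₂ b₂ : ℕ}
    (ha : a₁ + a₂ = 2 * a) (hb : b₁ + b₂ = 2 * b) (h₁ : 2 * (a₁ + b₁) ≤ d)
    (h₂ : 2 * (a₂ + b₂) ≤ d) :
    maxMoment μ U V a b ^ 2 ≤ maxMoment μ U V a₁ b₁ * maxMoment μ U V a₂ b₂ := by
  obtain ⟨w, z, hw, hz, he⟩ := exists_pairMoment_eq_maxMoment (μ := μ) (U := U) (V := V) hn a b
  rw [← he]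
  refine (h.pairMoment_sq_le ha hb h₁ h₂ w z).trans ?_
  exact mul_le_mul (pairMoment_le_maxMoment hn _ _ hw hz) (pairMoment_le_maxMoment hn _ _ hw hz)
    (h.pairMoment_nonneg h₂ w z)
    ((h.pairMoment_nonneg h₁ w z).trans (pairMoment_le_maxMoment hn _ _ hw hz))

/-- If all higher moments vanished, Cauchy–Schwarz would annihilate the moment multiplied by each
`u_i²`, and these sum to the original moment. Positivity is what allows taking logarithms of
`maxMoment`. -/
theorem exists_pairMoment_succ_pos (h : IsSpherePair d μ U V) {a b : ℕ}
    (hd : 2 * (a + b + 1) ≤ d) {w z : Fin n → ℝ} (hw : ∑ i, w i ^ 2 = 1)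
    (hpos : 0 < pairMoment μ U V a b w z) :
    ∃ w' : Fin n → ℝ, ∑ i, w' i ^ 2 = 1 ∧ 0 < pairMoment μ U V (a + 1) b w' z := by
  by_contra! hcon
  have hzero : ∀ w' : Fin n → ℝ, ∑ i, w' i ^ 2 = 1 → pairMoment μ U V (a + 1) b w' z = 0 :=
    fun w' hw' => le_antisymm (hcon w' hw') (h.pairMoment_nonneg (by omega) w' z)
  have hterm : ∀ i, pexp μ ((linForm U w ^ a * linForm V z ^ b) ^ 2 * U i ^ 2) = 0 := by
    intro i
    rcases a with _ | a
    · have h0 := hzero _ (sum_single_sq i)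
      unfold pairMoment at h0
      rw [linForm_single] at h0
      refine Eq.trans ?_ h0
      exact congrArg (pexp μ) (by ring)
    · have h0 := hzero _ hw
      -- An uneven splitting: the square of the first factor is exactly the moment assumed to
      -- vanish, at the old direction `w`.
      have hcs := pexp_mul_sq_le μ h.sq_nonneg (f := linForm U w ^ (a + 1 + 1) * linForm V z ^ b)
        (g := linForm U w ^ a * linForm V z ^ b * U i ^ 2)
        (by have := h.totalDegree_monomial (a + 1 + 1) b w z; omega)
        (by
          have := totalDegree_mul_le_of_le (h.totalDegree_monomial a b w z)
            (totalDegree_pow_le_of_le (h.degree_left i) 2)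
          omega)
      unfold pairMoment at h0
      have hcs : _ ≤ (0 : ℝ) := hcs.trans_eq (by rw [h0, zero_mul])
      have h1 := (sq_nonpos_iff _).mp hcs
      refine Eq.trans ?_ h1
      exact congrArg (pexp μ) (by ring)
  have hnorm := h.norm_left ((linForm U w ^ a * linForm V z ^ b) ^ 2) (by
    have := h.totalDegree_monomial a b w z
    have := totalDegree_pow (linForm U w ^ a * linForm V z ^ b) 2
    omega)
  rw [Finset.mul_sum, pexp_sum, Finset.sum_eq_zero fun i _ => hterm i] at hnorm
  exact hpos.ne hnorm

theorem exists_pairMoment_pos (h : IsSpherePair d μ U V) (hn : 0 < n) (a b : ℕ)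
    (hd : 2 * (a + b) ≤ d) :
    ∃ w z : Fin n → ℝ, ∑ i, w i ^ 2 = 1 ∧ ∑ i, z i ^ 2 = 1 ∧ 0 < pairMoment μ U V a b w z := by
  induction a with
  | zero =>
    induction b with
    | zero =>
      refine ⟨_, _, sum_single_sq ⟨0, hn⟩, sum_single_sq ⟨0, hn⟩, ?_⟩
      simp [pairMoment, h.pexp_one]
    | succ b ih =>
      obtain ⟨w, z, hw, hz, hpos⟩ := ih (by omega)
      rw [← pairMoment_swap] at hpos
      obtain ⟨z', hz', hpos'⟩ := h.symm.exists_pairMoment_succ_pos (by omega) hz hpos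
      exact ⟨w, z', hw, hz', by rwa [pairMoment_swap] at hpos'⟩
  | succ a ih =>
    obtain ⟨w, z, hw, hz, hpos⟩ := ih (by omega)
    obtain ⟨w', hw', hpos'⟩ := h.exists_pairMoment_succ_pos (by omega) hw hpos
    exact ⟨w', z, hw', hz, hpos'⟩

theorem maxMoment_pos (h : IsSpherePair d μ U V) (hn : 0 < n) {a b : ℕ}
    (hd : 2 * (a + b) ≤ d) : 0 < maxMoment μ U V a b := by
  obtain ⟨w, z, hw, hz, hpos⟩ := h.exists_pairMoment_pos hn a b hd
  exact hpos.trans_le (pairMoment_le_maxMoment hn a b hw hz)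

/-- At a maximizer, the second-order conditions add up to a lower bound on the growth of the
moments. -/
theorem pairMoment_le_of_max (h : IsSpherePair d μ U V) {a b : ℕ}
    (hd : 2 * (a + b + 1) ≤ d) {w z : Fin n → ℝ} (hw : ∑ i, w i ^ 2 = 1)
    (hmax : ∀ w' : Fin n → ℝ, ∑ i, w' i ^ 2 = 1 →
      pairMoment μ U V (a + 1) b w' z ≤ pairMoment μ U V (a + 1) b w z) :
    (2 * a + 1) * pairMoment μ U V a b w z ≤ (n + 2 * a) * pairMoment μ U V (a + 1) b w z := by
  have hm : ∀ w' : Fin n → ℝ, pexp μ ((linForm V z ^ b) ^ 2 * linForm U w' ^ (2 * a + 2)) =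
      pairMoment μ U V (a + 1) b w' z := by
    intro w'
    unfold pairMoment
    exact congrArg (pexp μ) (by ring)
  have hso : ∀ i, (2 * a + 1) * pexp μ ((linForm U w ^ a * linForm V z ^ b) ^ 2 *
      linForm U (Pi.single i 1 + (-w i) • w) ^ 2) ≤
      (1 - w i ^ 2) * pairMoment μ U V (a + 1) b w z := by
    intro i
    have h1 := sphere_second_order μ U {0} (fun _ => 2 * a + 2) (fun _ => (linForm V z ^ b) ^ 2) hw
      (sum_residual_mul hw i) (by simpa only [Finset.sum_singleton, hm] using hmax)
    simp only [Finset.sum_singleton, hm, sum_residual_sq hw] at h1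
    rw [show 2 * a + 2 - 1 = 2 * a + 1 by omega, show 2 * a + 2 - 2 = 2 * a by omega] at h1
    have e : (linForm V z ^ b) ^ 2 * linForm U w ^ (2 * a) *
        linForm U (Pi.single i 1 + (-w i) • w) ^ 2 = (linForm U w ^ a * linForm V z ^ b) ^ 2 *
        linForm U (Pi.single i 1 + (-w i) • w) ^ 2 := by ring
    rw [e] at h1
    push_cast at h1
    have hp : (0 : ℝ) < 2 * a + 2 := by positivity
    refine le_of_mul_le_mul_left ?_ hp
    linarith
  -- With `m_a` for the moment of exponent `a`, and since `∑ (1 - w i ^ 2) = n - 1`, the sum reads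
  -- `(2a+1)(m_a - m_{a+1}) ≤ (n-1) m_{a+1}`.
  have hsum := Finset.sum_le_sum fun i (_ : i ∈ Finset.univ) => hso i
  rw [← Finset.mul_sum, ← Finset.sum_mul, ← pexp_sum, ← Finset.mul_sum,
    sum_linForm_residual_sq U hw, mul_sub, pexp_sub, h.norm_left _ (by
      have := h.totalDegree_monomial a b w z
      have := totalDegree_pow (linForm U w ^ a * linForm V z ^ b) 2
      omega), Finset.sum_sub_distrib, hw] at hsum
  have e2 : pexp μ ((linForm U w ^ a * linForm V z ^ b) ^ 2 * linForm U w ^ 2) =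
      pairMoment μ U V (a + 1) b w z := by
    unfold pairMoment
    exact congrArg (pexp μ) (by ring)
  have e3 : pexp μ ((linForm U w ^ a * linForm V z ^ b) ^ 2) = pairMoment μ U V a b w z := rfl
  simp only [e2, e3, Finset.sum_const, Finset.card_univ, Fintype.card_fin, nsmul_eq_mul,
    mul_one] at hsum
  linarith

/-- The second-order condition compares exponent `a + 1` with `a` at a maximizer for `a + 1`.
Log-convexity in these same directions turns this into a comparison with `a + 2`, where passing to
the maximum goes the right way. -/
theorem maxMoment_le_succ (h : IsSpherePair d μ U V) (hn : 0 < n) {a b : ℕ}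
    (hd : 2 * (a + b + 2) ≤ d) :
    (2 * a + 1) * maxMoment μ U V (a + 1) b ≤ (n + 2 * a) * maxMoment μ U V (a + 2) b := by
  obtain ⟨w, z, hw, hz, he⟩ := exists_pairMoment_eq_maxMoment (μ := μ) (U := U) (V := V) hn (a + 1) b
  have h1 := h.pairMoment_le_of_max (a := a) (b := b) (by omega) hw (z := z) fun w' hw' => by
    rw [he]; exact pairMoment_le_maxMoment hn _ _ hw' hz
  have h2 := h.pairMoment_sq_le (a := a + 1) (b := b) (a₁ := a) (b₁ := b) (a₂ := a + 2) (b₂ := b)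
    (by omega) (by omega) (by omega) (by omega) w z
  have h3 := pairMoment_le_maxMoment (μ := μ) (U := U) (V := V) hn (a + 2) b hw hz
  have hM := h.maxMoment_pos hn (a := a + 1) (b := b) (by omega)
  have hm0 := h.pairMoment_nonneg (a := a) (b := b) (by omega) w z
  rw [he] at h1 h2
  have hpos2 := h.maxMoment_pos hn (a := a + 2) (b := b) (by omega)
  refine le_of_mul_le_mul_left ?_ hM
  calc maxMoment μ U V (a + 1) b * ((2 * a + 1) * maxMoment μ U V (a + 1) b)
      = (2 * a + 1) * maxMoment μ U V (a + 1) b ^ 2 := by ring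
    _ ≤ (2 * a + 1) * (pairMoment μ U V a b w z * maxMoment μ U V (a + 2) b) := by
        gcongr
        exact h2.trans (by gcongr)
    _ = ((2 * a + 1) * pairMoment μ U V a b w z) * maxMoment μ U V (a + 2) b := by ring
    _ ≤ ((n + 2 * a) * maxMoment μ U V (a + 1) b) * maxMoment μ U V (a + 2) b := by gcongr
    _ = _ := by ring

end IsSpherePair

/-! ### Exponents around which the moments are nearly geometric. -/

/-- A function on a grid with bounded increments has a point at which both second differences
are small on average. -/
theorem exists_second_diff_le (ψ : ℕ → ℕ → ℝ) {J : ℕ} (hJ : 0 < J) {Λ : ℝ}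
    (h₁ : ∀ i j, i ≤ J → j ≤ J → 0 ≤ ψ i j - ψ (i + 1) j ∧ ψ i j - ψ (i + 1) j ≤ Λ)
    (h₂ : ∀ i j, i ≤ J → j ≤ J → 0 ≤ ψ i j - ψ i (j + 1) ∧ ψ i j - ψ i (j + 1) ≤ Λ) :
    ∃ i j, i < J ∧ j < J ∧
      (ψ (i + 2) (j + 1) - 2 * ψ (i + 1) (j + 1) + ψ i (j + 1)) +
      (ψ (i + 1) (j + 2) - 2 * ψ (i + 1) (j + 1) + ψ (i + 1) j) ≤ 2 * Λ / J := by
  by_contra! hcon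
  have hJ' : (0 : ℝ) < J := by exact_mod_cast hJ
  -- Second differences along a line telescope to last increment minus first, at most `0 + Λ`. The
  -- `2 J` lines give `2 J Λ` in total, spread over `J ^ 2` points.
  have s₁ : ∀ j ∈ Finset.range J, ∑ i ∈ Finset.range J,
      (ψ (i + 2) (j + 1) - 2 * ψ (i + 1) (j + 1) + ψ i (j + 1)) ≤ Λ := by
    intro j hj
    have hj' := Finset.mem_range.mp hj
    have := Finset.sum_range_sub (fun i => ψ (i + 1) (j + 1) - ψ i (j + 1)) J
    have e : ∑ i ∈ Finset.range J, (ψ (i + 2) (j + 1) - 2 * ψ (i + 1) (j + 1) + ψ i (j + 1)) =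
        ∑ i ∈ Finset.range J, ((ψ (i + 1 + 1) (j + 1) - ψ (i + 1) (j + 1)) -
          (ψ (i + 1) (j + 1) - ψ i (j + 1))) :=
      Finset.sum_congr rfl fun i _ => by ring
    rw [e, this]
    have ha := h₁ J (j + 1) le_rfl (by omega)
    have hb := h₁ 0 (j + 1) (by omega) (by omega)
    linarith [ha.1, hb.2]
  have s₂ : ∀ i ∈ Finset.range J, ∑ j ∈ Finset.range J,
      (ψ (i + 1) (j + 2) - 2 * ψ (i + 1) (j + 1) + ψ (i + 1) j) ≤ Λ := by
    intro i hi
    have hi' := Finset.mem_range.mp hi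
    have := Finset.sum_range_sub (fun j => ψ (i + 1) (j + 1) - ψ (i + 1) j) J
    have e : ∑ j ∈ Finset.range J, (ψ (i + 1) (j + 2) - 2 * ψ (i + 1) (j + 1) + ψ (i + 1) j) =
        ∑ j ∈ Finset.range J, ((ψ (i + 1) (j + 1 + 1) - ψ (i + 1) (j + 1)) -
          (ψ (i + 1) (j + 1) - ψ (i + 1) j)) :=
      Finset.sum_congr rfl fun j _ => by ring
    rw [e, this]
    have ha := h₂ (i + 1) J (by omega) le_rfl
    have hb := h₂ (i + 1) 0 (by omega) (by omega)
    linarith [ha.1, hb.2]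
  have t₁ := Finset.sum_le_sum s₁
  have t₂ := Finset.sum_le_sum s₂
  rw [Finset.sum_comm] at t₁
  have t := add_le_add t₁ t₂
  rw [← Finset.sum_add_distrib] at t
  simp only [← Finset.sum_add_distrib, Finset.sum_const, Finset.card_range, nsmul_eq_mul] at t
  have hlt : ∑ i ∈ Finset.range J, ∑ j ∈ Finset.range J, 2 * Λ / J <
      ∑ i ∈ Finset.range J, ∑ j ∈ Finset.range J,
        ((ψ (i + 2) (j + 1) - 2 * ψ (i + 1) (j + 1) + ψ i (j + 1)) +
        (ψ (i + 1) (j + 2) - 2 * ψ (i + 1) (j + 1) + ψ (i + 1) j)) := by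
    refine Finset.sum_lt_sum_of_nonempty ⟨0, Finset.mem_range.mpr hJ⟩ fun i hi => ?_
    refine Finset.sum_lt_sum_of_nonempty ⟨0, Finset.mem_range.mpr hJ⟩ fun j hj => ?_
    exact hcon i j (Finset.mem_range.mp hi) (Finset.mem_range.mp hj)
  simp only [Finset.sum_const, Finset.card_range, nsmul_eq_mul] at hlt
  have : (J : ℝ) * (J * (2 * Λ / J)) = J * Λ + J * Λ := by field_simp; ring
  linarith

namespace IsSpherePair

variable {σ : Type} {n d : ℕ} {μ : SignedFn σ} {U V : Fin n → MvPolynomial σ ℝ}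

theorem log_maxMoment_mid_le (h : IsSpherePair d μ U V) (hn : 0 < n) {a b a₁ b₁ a₂ b₂ : ℕ}
    (ha : a₁ + a₂ = 2 * a) (hb : b₁ + b₂ = 2 * b) (h₁ : 2 * (a₁ + b₁) ≤ d)
    (h₂ : 2 * (a₂ + b₂) ≤ d) :
    2 * Real.log (maxMoment μ U V a b) ≤
      Real.log (maxMoment μ U V a₁ b₁) + Real.log (maxMoment μ U V a₂ b₂) := by
  have hle := h.maxMoment_mid_sq_le hn ha hb h₁ h₂
  have hpos := h.maxMoment_pos hn (a := a) (b := b) (by omega)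
  rw [← Real.log_mul (h.maxMoment_pos hn h₁).ne' (h.maxMoment_pos hn h₂).ne']
  have := Real.log_le_log (by positivity) hle
  rwa [Real.log_pow] at this

theorem log_maxMoment_succ_le (h : IsSpherePair d μ U V) (hn : 0 < n) {a b : ℕ}
    (hd : 2 * (a + b + 1) ≤ d) :
    Real.log (maxMoment μ U V (a + 1) b) ≤ Real.log (maxMoment μ U V a b) :=
  Real.log_le_log (h.maxMoment_pos hn (by omega)) (h.maxMoment_succ_le hn hd)

/-- The ratio `t/(n - 1 + t)` increases in `t = 2a + 1`. This is the source of the lower bound on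
`A`. -/
theorem log_maxMoment_le_succ (h : IsSpherePair d μ U V) (hn : 0 < n) {a b : ℕ}
    (hd : 2 * (a + b + 2) ≤ d) {J : ℝ} (hJ : 0 < J) (hJa : J ≤ 2 * a + 1) :
    Real.log (J / (n + J)) ≤
      Real.log (maxMoment μ U V (a + 2) b) - Real.log (maxMoment μ U V (a + 1) b) := by
  have h1 := h.maxMoment_le_succ hn hd
  have p1 := h.maxMoment_pos hn (a := a + 1) (b := b) (by omega)
  have p2 := h.maxMoment_pos hn (a := a + 2) (b := b) (by omega)
  have hn' : (1 : ℝ) ≤ n := by exact_mod_cast hn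
  rw [← Real.log_div p2.ne' p1.ne']
  refine Real.log_le_log (by positivity) ?_
  rw [div_le_div_iff₀ (by positivity) p1]
  have ha : (0 : ℝ) ≤ 2 * a := by positivity
  have hp : (0 : ℝ) < 2 * a + 1 := by positivity
  refine le_of_mul_le_mul_left ?_ hp
  have h2 := mul_le_mul_of_nonneg_left h1 hJ.le
  have h3 : J * (n + 2 * a) ≤ (2 * a + 1) * (n + J) := by nlinarith
  have h4 := mul_le_mul_of_nonneg_right h3 p2.le
  linarith

theorem log_maxMoment_sub_le (h : IsSpherePair d μ U V) (hn : 0 < n) {a b : ℕ}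
    (hd : 2 * (a + b + 2) ≤ d) :
    Real.log (maxMoment μ U V (a + 1) b) - Real.log (maxMoment μ U V (a + 2) b) ≤ Real.log n := by
  have h1 := h.maxMoment_le_succ hn hd
  have p1 := h.maxMoment_pos hn (a := a + 1) (b := b) (by omega)
  have p2 := h.maxMoment_pos hn (a := a + 2) (b := b) (by omega)
  have hn' : (1 : ℝ) ≤ n := by exact_mod_cast hn
  rw [← Real.log_div p1.ne' p2.ne']
  refine Real.log_le_log (by positivity) ?_
  rw [div_le_iff₀ p2]
  have ha : (0 : ℝ) ≤ 2 * a := by positivity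
  have hp : (0 : ℝ) < 2 * a + 1 := by positivity
  refine le_of_mul_le_mul_left ?_ hp
  have h3 : (n + 2 * a : ℝ) ≤ (2 * a + 1) * n := by nlinarith
  have h4 := mul_le_mul_of_nonneg_right h3 p2.le
  linarith

/-- Around some pair of exponents, the maximal moments are nearly geometric. -/
theorem exists_geometric_maxMoment (h : IsSpherePair d μ U V) (hn : 0 < n) {J : ℕ} (hJ : 2 ≤ J)
    (hd : 16 * J ≤ d) :
    ∃ (a b : ℕ) (N A B : ℝ), J ≤ b ∧ a + b + 4 ≤ 8 * J ∧ 0 < N ∧ (J : ℝ) / (n + J) ≤ A ∧ 0 < B ∧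
      maxMoment μ U V (a + 1) (b + 1) = N * A * B ∧
      ∀ i j, i ≤ 2 → j ≤ 2 → maxMoment μ U V (a + i) (b + j) ≤
        Real.exp (Real.log n / J) * (N * A ^ i * B ^ j) := by
  have hJ0 : (0 : ℝ) < J := by exact_mod_cast (by omega : 0 < J)
  set φ : ℕ → ℕ → ℝ := fun a b => Real.log (maxMoment μ U V a b) with hφ
  have hconv : ∀ {a b a₁ b₁ a₂ b₂ : ℕ}, a₁ + a₂ = 2 * a → b₁ + b₂ = 2 * b → a₁ + b₁ ≤ 8 * J →
      a₂ + b₂ ≤ 8 * J → 2 * φ a b ≤ φ a₁ b₁ + φ a₂ b₂ := fun ha hb h₁ h₂ =>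
    h.log_maxMoment_mid_le hn ha hb (by omega) (by omega)
  have hsw : ∀ a b, Real.log (maxMoment μ V U a b) = φ b a := fun a b => by
    rw [maxMoment_swap]
  -- The grid has mesh two, whence `Λ = 2 log n`, so that all intermediate exponents are midpoints.
  -- It starts at `2 (J - 1)`, which keeps the exponents found at least of order `J`.
  obtain ⟨i, j, hi, hj, hD⟩ := exists_second_diff_le
    (fun i j => φ (2 * (J - 1 + i)) (2 * (J - 1 + j))) (by omega : 0 < J) (Λ := 2 * Real.log n)
    (fun i j hi hj => by
      obtain ⟨c, hc⟩ : ∃ c, 2 * (J - 1 + i) = c + 1 := ⟨2 * (J - 1 + i) - 1, by omega⟩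
      have hc2 : 2 * (J - 1 + (i + 1)) = c + 3 := by omega
      simp only [hc, hc2]
      have e1 := h.log_maxMoment_sub_le hn (a := c) (b := 2 * (J - 1 + j)) (by omega)
      have e2 := h.log_maxMoment_sub_le hn (a := c + 1) (b := 2 * (J - 1 + j)) (by omega)
      have e3 := h.log_maxMoment_succ_le hn (a := c + 1) (b := 2 * (J - 1 + j)) (by omega)
      have e4 := h.log_maxMoment_succ_le hn (a := c + 2) (b := 2 * (J - 1 + j)) (by omega)
      constructor <;> simp only [hφ] <;> linarith)
    (fun i j hi hj => by
      obtain ⟨c, hc⟩ : ∃ c, 2 * (J - 1 + j) = c + 1 := ⟨2 * (J - 1 + j) - 1, by omega⟩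
      have hc2 : 2 * (J - 1 + (j + 1)) = c + 3 := by omega
      simp only [hc, hc2]
      have e1 := h.symm.log_maxMoment_sub_le hn (a := c) (b := 2 * (J - 1 + i)) (by omega)
      have e2 := h.symm.log_maxMoment_sub_le hn (a := c + 1) (b := 2 * (J - 1 + i)) (by omega)
      have e3 := h.symm.log_maxMoment_succ_le hn (a := c + 1) (b := 2 * (J - 1 + i)) (by omega)
      have e4 := h.symm.log_maxMoment_succ_le hn (a := c + 2) (b := 2 * (J - 1 + i)) (by omega)
      simp only [hsw] at e1 e2 e3 e4
      constructor <;> linarith)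
  obtain ⟨p, hp⟩ : ∃ p, p = 2 * (J - 1 + i) := ⟨_, rfl⟩
  obtain ⟨q, hq⟩ : ∃ q, q = 2 * (J - 1 + j) := ⟨_, rfl⟩
  rw [show 2 * (J - 1 + (i + 1)) = p + 2 by omega, show 2 * (J - 1 + (i + 2)) = p + 4 by omega,
    show 2 * (J - 1 + (j + 1)) = q + 2 by omega, show 2 * (J - 1 + (j + 2)) = q + 4 by omega,
    ← hp, ← hq] at hD
  -- The mean slopes across the centre become `log A` and `log B`; `N` is then chosen to make the
  -- centre exact.
  set s₁ : ℝ := (φ (p + 4) (q + 2) - φ p (q + 2)) / 4 with hs₁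
  set s₂ : ℝ := (φ (p + 2) (q + 4) - φ (p + 2) q) / 4 with hs₂
  set δ : ℝ := Real.log n / J with hδ
  have hD' : (φ (p + 4) (q + 2) - 2 * φ (p + 2) (q + 2) + φ p (q + 2)) +
      (φ (p + 2) (q + 4) - 2 * φ (p + 2) (q + 2) + φ (p + 2) q) ≤ 4 * δ := by
    refine hD.trans (le_of_eq ?_)
    rw [hδ]; ring
  refine ⟨p + 1, q + 1, Real.exp (φ (p + 2) (q + 2) - s₁ - s₂), Real.exp s₁, Real.exp s₂,
    by omega, by omega, Real.exp_pos _, ?_, Real.exp_pos _, ?_, ?_⟩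
  · rw [← Real.log_le_iff_le_exp (by positivity)]
    have hJp : (J : ℝ) ≤ 2 * ((p - 1 : ℕ) : ℝ) + 1 := by
      exact_mod_cast (by omega : J ≤ 2 * (p - 1) + 1)
    obtain ⟨r, hr⟩ : ∃ r, p = r + 1 := ⟨p - 1, by omega⟩
    rw [hr, Nat.add_sub_cancel] at hJp
    -- The slope `s₁` averages four unit increments, each at least `log (J / (n + J))`.
    have f1 := h.log_maxMoment_le_succ hn (a := r) (b := q + 2) (by omega) hJ0 hJp
    have f2 := h.log_maxMoment_le_succ hn (a := r + 1) (b := q + 2) (by omega) hJ0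
      (by push_cast; linarith)
    have f3 := h.log_maxMoment_le_succ hn (a := r + 2) (b := q + 2) (by omega) hJ0
      (by push_cast; linarith)
    have f4 := h.log_maxMoment_le_succ hn (a := r + 3) (b := q + 2) (by omega) hJ0
      (by push_cast; linarith)
    rw [hs₁, hr]
    simp only [hφ]
    linarith
  · rw [← Real.exp_add, ← Real.exp_add, show φ (p + 2) (q + 2) - s₁ - s₂ + s₁ + s₂ =
      φ (p + 2) (q + 2) by ring]
    exact (Real.exp_log (h.maxMoment_pos hn (by omega))).symm
  -- Each of the eight outer points is the midpoint of two points among the centre and the four tips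
  -- of the cross. The last two inequalities make both second differences nonnegative, so each alone
  -- is at most `4 δ`.
  · have c1 : 2 * φ (p + 1) (q + 2) ≤ φ p (q + 2) + φ (p + 2) (q + 2) :=
      hconv (by omega) (by omega) (by omega) (by omega)
    have c2 : 2 * φ (p + 3) (q + 2) ≤ φ (p + 4) (q + 2) + φ (p + 2) (q + 2) :=
      hconv (by omega) (by omega) (by omega) (by omega)
    have c3 : 2 * φ (p + 2) (q + 1) ≤ φ (p + 2) q + φ (p + 2) (q + 2) :=
      hconv (by omega) (by omega) (by omega) (by omega)
    have c4 : 2 * φ (p + 2) (q + 3) ≤ φ (p + 2) (q + 4) + φ (p + 2) (q + 2) :=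
      hconv (by omega) (by omega) (by omega) (by omega)
    have c5 : 2 * φ (p + 1) (q + 1) ≤ φ p (q + 2) + φ (p + 2) q :=
      hconv (by omega) (by omega) (by omega) (by omega)
    have c6 : 2 * φ (p + 1) (q + 3) ≤ φ p (q + 2) + φ (p + 2) (q + 4) :=
      hconv (by omega) (by omega) (by omega) (by omega)
    have c7 : 2 * φ (p + 3) (q + 1) ≤ φ (p + 4) (q + 2) + φ (p + 2) q :=
      hconv (by omega) (by omega) (by omega) (by omega)
    have c8 : 2 * φ (p + 3) (q + 3) ≤ φ (p + 4) (q + 2) + φ (p + 2) (q + 4) :=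
      hconv (by omega) (by omega) (by omega) (by omega)
    have c9 : 2 * φ (p + 2) (q + 2) ≤ φ p (q + 2) + φ (p + 4) (q + 2) :=
      hconv (by omega) (by omega) (by omega) (by omega)
    have c10 : 2 * φ (p + 2) (q + 2) ≤ φ (p + 2) q + φ (p + 2) (q + 4) :=
      hconv (by omega) (by omega) (by omega) (by omega)
    have hlog : ∀ i j : ℕ, i ≤ 2 → j ≤ 2 → φ (p + 1 + i) (q + 1 + j) ≤
        δ + (φ (p + 2) (q + 2) - s₁ - s₂ + i * s₁ + j * s₂) := by
      intro i j hi hj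
      rw [hs₁, hs₂]
      interval_cases i <;> interval_cases j <;> push_cast <;> simp only [add_assoc, add_zero] <;>
        norm_num at * <;> linarith
    intro i j hi hj
    have := hlog i j hi hj
    rw [← Real.exp_nat_mul, ← Real.exp_nat_mul, ← Real.exp_add, ← Real.exp_add, ← Real.exp_add,
      ← Real.log_le_iff_le_exp (h.maxMoment_pos hn (by omega))]
    exact this

end IsSpherePair

/-! ### Concentration under a polynomial weight. -/

section Expansions

variable {σ : Type} (μ : SignedFn σ) (x y f : MvPolynomial σ ℝ) (a b : ℕ)

theorem pexp_sq_weight (A B : ℝ) :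
    pexp μ ((x ^ a * y ^ b * (x ^ 2 + C A) * (y ^ 2 + C B) * f) ^ 2) =
      A ^ 2 * B ^ 2 * pexp μ ((x ^ a * y ^ b * f) ^ 2) +
      2 * A ^ 2 * B * pexp μ ((x ^ a * y ^ (b + 1) * f) ^ 2) +
      A ^ 2 * pexp μ ((x ^ a * y ^ (b + 2) * f) ^ 2) +
      2 * A * B ^ 2 * pexp μ ((x ^ (a + 1) * y ^ b * f) ^ 2) +
      4 * A * B * pexp μ ((x ^ (a + 1) * y ^ (b + 1) * f) ^ 2) +
      2 * A * pexp μ ((x ^ (a + 1) * y ^ (b + 2) * f) ^ 2) +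
      B ^ 2 * pexp μ ((x ^ (a + 2) * y ^ b * f) ^ 2) +
      2 * B * pexp μ ((x ^ (a + 2) * y ^ (b + 1) * f) ^ 2) +
      pexp μ ((x ^ (a + 2) * y ^ (b + 2) * f) ^ 2) := by
  simp only [← pexp_C_mul, ← pexp_add]
  refine congrArg (pexp μ) ?_
  simp only [C_mul, C_pow, map_ofNat]
  ring

/-- Averaging over the signs of `α` and `β` removes the odd powers, leaving only even moments, the
ones that `maxMoment` controls. -/
theorem pexp_sq_signs (α β : ℝ) :
    pexp μ ((x ^ a * y ^ b * (x + C α) * (y + C β) * f) ^ 2) +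
      pexp μ ((x ^ a * y ^ b * (x + C α) * (y + C (-β)) * f) ^ 2) +
      pexp μ ((x ^ a * y ^ b * (x + C (-α)) * (y + C β) * f) ^ 2) +
      pexp μ ((x ^ a * y ^ b * (x + C (-α)) * (y + C (-β)) * f) ^ 2) =
    4 * (pexp μ ((x ^ (a + 1) * y ^ (b + 1) * f) ^ 2) +
      β ^ 2 * pexp μ ((x ^ (a + 1) * y ^ b * f) ^ 2) +
      α ^ 2 * pexp μ ((x ^ a * y ^ (b + 1) * f) ^ 2) +
      α ^ 2 * β ^ 2 * pexp μ ((x ^ a * y ^ b * f) ^ 2)) := by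
  simp only [← pexp_C_mul, ← pexp_add]
  refine congrArg (pexp μ) ?_
  simp only [C_mul, C_pow, C_neg, map_ofNat]
  ring

/-- Since `(x + α)(x - α) = x² - α²`, the deviation of `x` from `α` under this weight is a second
difference of even moments; both signs of `β` remove the odd powers of `y`. -/
theorem pexp_sq_deviation (α β : ℝ) :
    pexp μ ((x ^ a * y ^ b * (x + C α) * (y + C β) * (x - C α)) ^ 2) +
      pexp μ ((x ^ a * y ^ b * (x + C α) * (y + C (-β)) * (x - C α)) ^ 2) =
    2 * (pexp μ ((x ^ (a + 2) * y ^ (b + 1)) ^ 2) -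
        2 * α ^ 2 * pexp μ ((x ^ (a + 1) * y ^ (b + 1)) ^ 2) +
        (α ^ 2) ^ 2 * pexp μ ((x ^ a * y ^ (b + 1)) ^ 2) +
      β ^ 2 * (pexp μ ((x ^ (a + 2) * y ^ b) ^ 2) -
        2 * α ^ 2 * pexp μ ((x ^ (a + 1) * y ^ b) ^ 2) +
        (α ^ 2) ^ 2 * pexp μ ((x ^ a * y ^ b) ^ 2))) := by
  simp only [← pexp_C_mul, ← pexp_add, ← pexp_sub]
  refine congrArg (pexp μ) ?_
  simp only [C_mul, C_pow, C_neg, map_ofNat]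
  ring

end Expansions

namespace IsSpherePair

variable {σ : Type} {n d : ℕ} {μ : SignedFn σ} {U V : Fin n → MvPolynomial σ ℝ}

/-- At a maximizer of the moment of `x ^ (2 a) (x² + A)² y ^ (2 b) (y² + B)²`, the second moments
of `v` orthogonal to `z` are small. -/
theorem pexp_orthogonal_le (h : IsSpherePair d μ U V) {a b : ℕ} {A B : ℝ} (hB : 0 < B) (hd : 2 * (a + b + 5) ≤ d) {w z : Fin n → ℝ} (hz : ∑ i, z i ^ 2 = 1)
    (hmax : ∀ z' : Fin n → ℝ, ∑ i, z' i ^ 2 = 1 →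
      pexp μ ((linForm U w ^ a * linForm V z' ^ (b + 1) * (linForm U w ^ 2 + C A) *
        (linForm V z' ^ 2 + C B)) ^ 2) ≤
      pexp μ ((linForm U w ^ a * linForm V z ^ (b + 1) * (linForm U w ^ 2 + C A) *
        (linForm V z ^ 2 + C B)) ^ 2))
    {e : Fin n → ℝ} (hze : ∑ i, z i * e i = 0) :
    (b + 1) * pexp μ ((linForm U w ^ a * linForm V z ^ b * (linForm U w ^ 2 + C A) *
        (linForm V z ^ 2 + C B) * linForm V e) ^ 2) ≤
      3 * (∑ i, e i ^ 2) * pexp μ ((linForm U w ^ a * linForm V z ^ (b + 1) *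
        (linForm U w ^ 2 + C A) * (linForm V z ^ 2 + C B)) ^ 2) := by
  set x := linForm U w with hx
  have dx : x.totalDegree ≤ 1 := totalDegree_linForm h.degree_left w
  have dx2 : (x ^ 2 + C A).totalDegree ≤ 2 :=
    totalDegree_add_le_of_le (totalDegree_pow_le_of_le dx 2) (totalDegree_C_le A 2)
  have dv : ∀ e, (linForm V e).totalDegree ≤ 1 := totalDegree_linForm h.degree_right
  set Q : MvPolynomial σ ℝ := (x ^ a * (x ^ 2 + C A)) ^ 2 with hQ
  -- The coefficients of `(y² + B)²`, which split the objective into pure powers `y ^ (2 (b + 1 +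
  -- j))`.
  set c : ℕ → ℝ := fun j => if j = 0 then B ^ 2 else if j = 1 then 2 * B else 1 with hc
  have hG : ∀ z', pexp μ ((x ^ a * linForm V z' ^ (b + 1) * (x ^ 2 + C A) *
      (linForm V z' ^ 2 + C B)) ^ 2) =
      ∑ j ∈ Finset.range 3, pexp μ (C (c j) * Q * linForm V z' ^ (2 * (b + 1 + j))) := by
    intro z'
    simp only [Finset.sum_range_succ, Finset.sum_range_zero, zero_add, ← pexp_add]
    refine congrArg (pexp μ) ?_
    simp only [hc, hQ, C_mul, C_pow, map_ofNat, if_true, one_ne_zero, if_false, map_one,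
      OfNat.ofNat_ne_zero, OfNat.ofNat_ne_one]
    ring
  have hH : pexp μ ((x ^ a * linForm V z ^ b * (x ^ 2 + C A) *
      (linForm V z ^ 2 + C B) * linForm V e) ^ 2) = ∑ j ∈ Finset.range 3,
        c j * pexp μ ((x ^ a * (x ^ 2 + C A) * linForm V z ^ (b + j) * linForm V e) ^ 2) := by
    simp only [Finset.sum_range_succ, Finset.sum_range_zero, zero_add, ← pexp_C_mul, ← pexp_add]
    refine congrArg (pexp μ) ?_
    simp only [hc, C_mul, C_pow, map_ofNat, if_true, one_ne_zero, if_false, map_one,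
      OfNat.ofNat_ne_zero, OfNat.ofNat_ne_one]
    ring
  have hso := sphere_second_order μ V (Finset.range 3) (fun j => 2 * (b + 1 + j))
    (fun j => C (c j) * Q) hz hze (fun z' hz' => by simpa only [hG] using hmax z' hz')
  have hc0 : ∀ j, 0 ≤ c j := fun j => by
    simp only [hc]; split_ifs <;> positivity
  have hR : ∀ j ∈ Finset.range 3,
      0 ≤ pexp μ ((x ^ a * (x ^ 2 + C A) * linForm V z ^ (b + j) * linForm V e) ^ 2) := by
    intro j hj
    have hj' := Finset.mem_range.mp hj
    refine h.sq_nonneg _ ?_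
    have := totalDegree_mul_le_of_le (totalDegree_mul_le_of_le (totalDegree_mul_le_of_le
      (totalDegree_pow_le_of_le dx a) dx2) (totalDegree_pow_le_of_le (dv z) (b + j))) (dv e)
    omega
  have hS : ∀ j ∈ Finset.range 3, 0 ≤ pexp μ (C (c j) * Q * linForm V z ^ (2 * (b + 1 + j))) := by
    intro j hj
    have hj' := Finset.mem_range.mp hj
    have e1 : C (c j) * Q * linForm V z ^ (2 * (b + 1 + j)) =
        C (c j) * (x ^ a * (x ^ 2 + C A) * linForm V z ^ (b + 1 + j)) ^ 2 := by
      rw [hQ]; ring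
    rw [e1, pexp_C_mul]
    refine mul_nonneg (hc0 j) (h.sq_nonneg _ ?_)
    have := totalDegree_mul_le_of_le (totalDegree_mul_le_of_le
      (totalDegree_pow_le_of_le dx a) dx2) (totalDegree_pow_le_of_le (dv z) (b + 1 + j))
    omega
  have hE : 0 ≤ ∑ i, e i ^ 2 := Finset.sum_nonneg fun i _ => _root_.sq_nonneg _
  have lower : (2 * (b + 1) * (2 * b + 1) : ℝ) * pexp μ ((x ^ a * linForm V z ^ b *
      (x ^ 2 + C A) * (linForm V z ^ 2 + C B) * linForm V e) ^ 2) ≤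
      ∑ j ∈ Finset.range 3, ((2 * (b + 1 + j) : ℕ) : ℝ) * ((2 * (b + 1 + j) - 1 : ℕ) : ℝ) *
        pexp μ (C (c j) * Q * linForm V z ^ (2 * (b + 1 + j) - 2) * linForm V e ^ 2) := by
    rw [hH, Finset.mul_sum]
    refine Finset.sum_le_sum fun j hj => ?_
    have e1 : C (c j) * Q * linForm V z ^ (2 * (b + 1 + j) - 2) * linForm V e ^ 2 =
        C (c j) * (x ^ a * (x ^ 2 + C A) * linForm V z ^ (b + j) * linForm V e) ^ 2 := by
      rw [hQ, show 2 * (b + 1 + j) - 2 = 2 * (b + j) by omega]; ring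
    rw [e1, pexp_C_mul, show 2 * (b + 1 + j) - 1 = 2 * (b + j) + 1 by omega]
    refine mul_le_mul_of_nonneg_right ?_ (mul_nonneg (hc0 j) (hR j hj))
    push_cast
    have hj0 : (0 : ℝ) ≤ j := by positivity
    have hb0 : (0 : ℝ) ≤ b := by positivity
    nlinarith [mul_nonneg hj0 hb0, mul_nonneg hj0 hj0]
  have upper : ∑ j ∈ Finset.range 3, ((2 * (b + 1 + j) : ℕ) : ℝ) *
        pexp μ (C (c j) * Q * linForm V z ^ (2 * (b + 1 + j))) ≤
      (2 * (b + 1) + 4 : ℝ) * pexp μ ((x ^ a * linForm V z ^ (b + 1) * (x ^ 2 + C A) *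
      (linForm V z ^ 2 + C B)) ^ 2) := by
    rw [hG, Finset.mul_sum]
    refine Finset.sum_le_sum fun j hj => ?_
    refine mul_le_mul_of_nonneg_right ?_ (hS j hj)
    have hj' : (j : ℝ) ≤ 2 := by
      have := Finset.mem_range.mp hj
      exact_mod_cast (by omega : j ≤ 2)
    push_cast
    linarith
  have hchain := lower.trans (hso.trans (mul_le_mul_of_nonneg_left upper hE))
  have hGz : 0 ≤ pexp μ ((x ^ a * linForm V z ^ (b + 1) * (x ^ 2 + C A) *
      (linForm V z ^ 2 + C B)) ^ 2) := by
    rw [hG]; exact Finset.sum_nonneg hS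
  have hb0 : (0 : ℝ) ≤ b := by positivity
  have hp : (0 : ℝ) < 2 * (2 * b + 1) := by positivity
  refine le_of_mul_le_mul_left ?_ hp
  have hEG := mul_nonneg hE hGz
  -- The constant `3` comes from `2b + 6 ≤ 6 (2b + 1)`, sharp at `b = 0`.
  have h6 : (2 * (b + 1) + 4 : ℝ) * ((∑ i, e i ^ 2) * pexp μ ((x ^ a * linForm V z ^ (b + 1) *
      (x ^ 2 + C A) * (linForm V z ^ 2 + C B)) ^ 2)) ≤ 2 * (2 * b + 1) * 3 *
      ((∑ i, e i ^ 2) * pexp μ ((x ^ a * linForm V z ^ (b + 1) *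
      (x ^ 2 + C A) * (linForm V z ^ 2 + C B)) ^ 2)) :=
    mul_le_mul_of_nonneg_right (by linarith) hEG
  linarith

end IsSpherePair

namespace IsSpherePair

variable {σ : Type} {n d : ℕ} {μ : SignedFn σ} {U V : Fin n → MvPolynomial σ ℝ}

/-- If the maximal moments are nearly geometric around some exponents, with ratios `A` and `B`, then
reweighting by a suitable square concentrates `⟨u, w⟩` near a root of `A` and `⟨v, z⟩` near a root
of `B`, and makes `v` small in the directions orthogonal to `z`. -/
theorem exists_concentrated_weight (h : IsSpherePair d μ U V) (hn : 0 < n) {a b : ℕ}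
    {N A B η : ℝ} (hd : 2 * (a + b + 6) ≤ d) (hN : 0 < N) (hA : 0 < A) (hB : 0 < B)
    (hη0 : 0 ≤ η) (hη : η ≤ 1 / 200) (hc : maxMoment μ U V (a + 1) (b + 2) = N * A * B)
    (hup : ∀ i j, i ≤ 2 → j ≤ 2 →
      maxMoment μ U V (a + i) (b + 1 + j) ≤ (1 + η) * (N * A ^ i * B ^ j)) :
    ∃ (w z : Fin n → ℝ) (α β : ℝ) (s : MvPolynomial σ ℝ), ∑ i, w i ^ 2 = 1 ∧ ∑ i, z i ^ 2 = 1 ∧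
      s.totalDegree ≤ a + b + 3 ∧ α ^ 2 = A ∧ β ^ 2 = B ∧ 0 < pexp μ (s ^ 2) ∧
      pexp μ ((s * (linForm U w - C α)) ^ 2) ≤ 32 * η * A * pexp μ (s ^ 2) ∧
      pexp μ ((s * (linForm V z - C β)) ^ 2) ≤ 32 * η * B * pexp μ (s ^ 2) ∧
      ∀ e : Fin n → ℝ, ∑ i, z i * e i = 0 →
        pexp μ ((s * linForm V e) ^ 2) ≤
          65 * B / (b + 1) * (∑ i, e i ^ 2) * pexp μ (s ^ 2) := by
  have hGexp : ∀ w z : Fin n → ℝ, pexp μ ((linForm U w ^ a * linForm V z ^ (b + 1) *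
      (linForm U w ^ 2 + C A) * (linForm V z ^ 2 + C B)) ^ 2) =
      A ^ 2 * B ^ 2 * pairMoment μ U V (a + 0) (b + 1 + 0) w z +
      2 * A ^ 2 * B * pairMoment μ U V (a + 0) (b + 1 + 1) w z +
      A ^ 2 * pairMoment μ U V (a + 0) (b + 1 + 2) w z +
      2 * A * B ^ 2 * pairMoment μ U V (a + 1) (b + 1 + 0) w z +
      4 * A * B * pairMoment μ U V (a + 1) (b + 1 + 1) w z +
      2 * A * pairMoment μ U V (a + 1) (b + 1 + 2) w z +
      B ^ 2 * pairMoment μ U V (a + 2) (b + 1 + 0) w z +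
      2 * B * pairMoment μ U V (a + 2) (b + 1 + 1) w z +
      pairMoment μ U V (a + 2) (b + 1 + 2) w z := by
    intro w z
    have := pexp_sq_weight μ (linForm U w) (linForm V z) 1 a (b + 1) A B
    simp only [mul_one] at this
    exact this
  -- Maximizing this even weight rather than the central moment gives a second-order condition for a
  -- weight that controls the final `s ^ 2`.
  obtain ⟨w, z, hw, hz, hmax⟩ := exists_max_unitPair hn
    (F := fun w z => pexp μ ((linForm U w ^ a * linForm V z ^ (b + 1) *
      (linForm U w ^ 2 + C A) * (linForm V z ^ 2 + C B)) ^ 2)) (by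
      simp only [pexp, map_mul, map_pow, map_add, eval_linForm, eval_C]
      fun_prop)
  obtain ⟨w₀, z₀, hw₀, hz₀, he₀⟩ :=
    exists_pairMoment_eq_maxMoment (μ := μ) (U := U) (V := V) hn (a + 1) (b + 2)
  rw [hc] at he₀
  -- At a maximizer of the central moment, Cauchy–Schwarz between the opposite exponents `(i, j)`
  -- and `(2 - i, 2 - j)` turns upper bounds into lower bounds.
  have hlow : ∀ i j, i ≤ 2 → j ≤ 2 →
      (1 - η) * (N * A ^ i * B ^ j) ≤ pairMoment μ U V (a + i) (b + 1 + j) w₀ z₀ := by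
    intro i j hi hj
    have hcs := h.pairMoment_sq_le (a := a + 1) (b := b + 2) (a₁ := a + i) (b₁ := b + 1 + j)
      (a₂ := a + (2 - i)) (b₂ := b + 1 + (2 - j)) (by omega) (by omega) (by omega) (by omega) w₀ z₀
    have hP : N * A ^ i * B ^ j * (N * A ^ (2 - i) * B ^ (2 - j)) = (N * A * B) ^ 2 := by
      have e1 : A ^ i * A ^ (2 - i) = A ^ 2 := by rw [← pow_add]; congr 1; omega
      have e2 : B ^ j * B ^ (2 - j) = B ^ 2 := by rw [← pow_add]; congr 1; omega
      calc _ = N ^ 2 * (A ^ i * A ^ (2 - i)) * (B ^ j * B ^ (2 - j)) := by ring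
        _ = _ := by rw [e1, e2]; ring
    have hT := h.pairMoment_nonneg (a := a + i) (b := b + 1 + j) (by omega) w₀ z₀
    have hT' := (pairMoment_le_maxMoment (μ := μ) (U := U) (V := V) hn (a + (2 - i))
      (b + 1 + (2 - j)) hw₀ hz₀).trans (hup (2 - i) (2 - j) (by omega) (by omega))
    have hP' : 0 < N * A ^ (2 - i) * B ^ (2 - j) := by positivity
    rw [he₀, ← hP] at hcs
    have h1 : N * A ^ i * B ^ j ≤ pairMoment μ U V (a + i) (b + 1 + j) w₀ z₀ * (1 + η) := by
      refine le_of_mul_le_mul_right ?_ hP'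
      calc _ ≤ _ := hcs
        _ ≤ _ := mul_le_mul_of_nonneg_left hT' hT
        _ = _ := by ring
    have h2 := mul_le_mul_of_nonneg_left h1 (by linarith : 0 ≤ 1 - η)
    nlinarith [mul_nonneg hT (_root_.sq_nonneg η)]
  have ht : ∀ i j, i ≤ 2 → j ≤ 2 → ∃ t, t ≤ 1 + η ∧
      pairMoment μ U V (a + i) (b + 1 + j) w z = t * (N * A ^ i * B ^ j) := by
    intro i j hi hj
    have hP : 0 < N * A ^ i * B ^ j := by positivity
    refine ⟨pairMoment μ U V (a + i) (b + 1 + j) w z / (N * A ^ i * B ^ j), ?_, ?_⟩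
    · rw [div_le_iff₀ hP]
      exact (pairMoment_le_maxMoment hn _ _ hw hz).trans (hup i j hi hj)
    · field_simp
  obtain ⟨t00, u00, e00⟩ := ht 0 0 (by omega) (by omega)
  obtain ⟨t01, u01, e01⟩ := ht 0 1 (by omega) (by omega)
  obtain ⟨t02, u02, e02⟩ := ht 0 2 (by omega) (by omega)
  obtain ⟨t10, u10, e10⟩ := ht 1 0 (by omega) (by omega)
  obtain ⟨t11, u11, e11⟩ := ht 1 1 (by omega) (by omega)
  obtain ⟨t12, u12, e12⟩ := ht 1 2 (by omega) (by omega)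
  obtain ⟨t20, u20, e20⟩ := ht 2 0 (by omega) (by omega)
  obtain ⟨t21, u21, e21⟩ := ht 2 1 (by omega) (by omega)
  obtain ⟨t22, u22, e22⟩ := ht 2 2 (by omega) (by omega)
  have hG : pexp μ ((linForm U w ^ a * linForm V z ^ (b + 1) *
      (linForm U w ^ 2 + C A) * (linForm V z ^ 2 + C B)) ^ 2) =
      (N * A ^ 2 * B ^ 2) * (t00 + 2 * t01 + t02 + 2 * t10 + 4 * t11 + 2 * t12 + t20 + 2 * t21 +
        t22) := by
    rw [hGexp, e00, e01, e02, e10, e11, e12, e20, e21, e22]; ring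
  have hNAB : 0 < N * A ^ 2 * B ^ 2 := by positivity
  -- The weights sum to `16` and every `t` is at most `1 + η`, so every `t` is `1` up to `O(η)`.
  have hsum : 16 * (1 - η) ≤ t00 + 2 * t01 + t02 + 2 * t10 + 4 * t11 + 2 * t12 + t20 + 2 * t21 +
      t22 := by
    refine le_of_mul_le_mul_left ?_ hNAB
    have h1 := hmax w₀ z₀ hw₀ hz₀
    simp only [hG] at h1
    refine le_trans ?_ h1
    rw [hGexp]
    have l00 := mul_le_mul_of_nonneg_left (hlow 0 0 (by omega) (by omega))
      (by positivity : 0 ≤ A ^ 2 * B ^ 2)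
    have l01 := mul_le_mul_of_nonneg_left (hlow 0 1 (by omega) (by omega))
      (by positivity : 0 ≤ 2 * A ^ 2 * B)
    have l02 := mul_le_mul_of_nonneg_left (hlow 0 2 (by omega) (by omega))
      (by positivity : 0 ≤ A ^ 2)
    have l10 := mul_le_mul_of_nonneg_left (hlow 1 0 (by omega) (by omega))
      (by positivity : 0 ≤ 2 * A * B ^ 2)
    have l11 := mul_le_mul_of_nonneg_left (hlow 1 1 (by omega) (by omega))
      (by positivity : 0 ≤ 4 * A * B)
    have l12 := mul_le_mul_of_nonneg_left (hlow 1 2 (by omega) (by omega))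
      (by positivity : 0 ≤ 2 * A)
    have l20 := mul_le_mul_of_nonneg_left (hlow 2 0 (by omega) (by omega))
      (by positivity : 0 ≤ B ^ 2)
    have l21 := mul_le_mul_of_nonneg_left (hlow 2 1 (by omega) (by omega))
      (by positivity : 0 ≤ 2 * B)
    have l22 := hlow 2 2 (by omega) (by omega)
    refine le_trans (le_of_eq ?_) (add_le_add (add_le_add (add_le_add (add_le_add (add_le_add
      (add_le_add (add_le_add (add_le_add l00 l01) l02) l10) l11) l12) l20) l21) l22)
    ring
  have dx : (linForm U w).totalDegree ≤ 1 := totalDegree_linForm h.degree_left w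
  have dv : ∀ e, (linForm V e).totalDegree ≤ 1 := totalDegree_linForm h.degree_right
  have ds : ∀ α β : ℝ, (linForm U w ^ a * linForm V z ^ (b + 1) * (linForm U w + C α) *
      (linForm V z + C β)).totalDegree ≤ a + b + 3 := by
    intro α β
    have := totalDegree_mul_le_of_le (totalDegree_mul_le_of_le
      (h.totalDegree_monomial a (b + 1) w z)
      (totalDegree_add_le_of_le dx (totalDegree_C_le α 1)))
      (totalDegree_add_le_of_le (dv z) (totalDegree_C_le β 1))
    omega
  have hnn : ∀ (α β : ℝ) (f : MvPolynomial σ ℝ), f.totalDegree ≤ 1 →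
      0 ≤ pexp μ ((linForm U w ^ a * linForm V z ^ (b + 1) * (linForm U w + C α) *
      (linForm V z + C β) * f) ^ 2) := by
    intro α β f hf
    refine h.sq_nonneg _ ?_
    have := totalDegree_mul_le_of_le (ds α β) hf
    omega
  have hW : ∀ α β : ℝ, α ^ 2 = A → β ^ 2 = B →
      pexp μ ((linForm U w ^ a * linForm V z ^ (b + 1) * (linForm U w + C α) *
        (linForm V z + C β)) ^ 2) +
      pexp μ ((linForm U w ^ a * linForm V z ^ (b + 1) * (linForm U w + C α) *
        (linForm V z + C (-β))) ^ 2) +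
      pexp μ ((linForm U w ^ a * linForm V z ^ (b + 1) * (linForm U w + C (-α)) *
        (linForm V z + C β)) ^ 2) +
      pexp μ ((linForm U w ^ a * linForm V z ^ (b + 1) * (linForm U w + C (-α)) *
        (linForm V z + C (-β))) ^ 2) = 4 * (N * A * B * (t11 + t10 + t01 + t00)) := by
    intro α β hα hβ
    have h1 := pexp_sq_signs μ (linForm U w) (linForm V z) 1 a (b + 1) α β
    simp only [mul_one] at h1
    rw [h1, hα, hβ]
    change 4 * (pairMoment μ U V (a + 1) (b + 1 + 1) w z +
      B * pairMoment μ U V (a + 1) (b + 1 + 0) w z + A * pairMoment μ U V (a + 0) (b + 1 + 1) w z +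
      A * B * pairMoment μ U V (a + 0) (b + 1 + 0) w z) = _
    rw [e00, e01, e10, e11]; ring
  have hW3 : 3 ≤ t11 + t10 + t01 + t00 := by linarith
  have hpos : 0 < N * A * B := by positivity
  -- The four sign choices have average mass at least `3 N A B`, so one of them has this mass.
  obtain ⟨α, β, hα, hβ, hs⟩ : ∃ α β : ℝ, α ^ 2 = A ∧ β ^ 2 = B ∧ 3 * (N * A * B) ≤
      pexp μ ((linForm U w ^ a * linForm V z ^ (b + 1) * (linForm U w + C α) *
        (linForm V z + C β)) ^ 2) := by
    by_contra! hcon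
    have hα := Real.sq_sqrt hA.le
    have hβ := Real.sq_sqrt hB.le
    have hα' : (-√A) ^ 2 = A := by rw [neg_sq, hα]
    have hβ' : (-√B) ^ 2 = B := by rw [neg_sq, hβ]
    have h0 := hW _ _ hα hβ
    have h1 := hcon _ _ hα hβ
    have h2 := hcon _ _ hα hβ'
    have h3 := hcon _ _ hα' hβ
    have h4 := hcon _ _ hα' hβ'
    have h5 := mul_le_mul_of_nonneg_left hW3 hpos.le
    linarith
  set s := linForm U w ^ a * linForm V z ^ (b + 1) * (linForm U w + C α) * (linForm V z + C β)
    with hsdef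
  refine ⟨w, z, α, β, s, hw, hz, ds α β, hα, hβ, by linarith [hpos], ?_, ?_, ?_⟩
  · have h1 := pexp_sq_deviation μ (linForm U w) (linForm V z) a (b + 1) α β
    have h2 := hnn α (-β) (linForm U w - C α)
      (totalDegree_sub_le_of_le dx (totalDegree_C_le α 1))
    rw [hα, hβ] at h1
    change _ = 2 * (pairMoment μ U V (a + 2) (b + 1 + 1) w z -
      2 * A * pairMoment μ U V (a + 1) (b + 1 + 1) w z +
      A ^ 2 * pairMoment μ U V (a + 0) (b + 1 + 1) w z +
      B * (pairMoment μ U V (a + 2) (b + 1 + 0) w z -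
      2 * A * pairMoment μ U V (a + 1) (b + 1 + 0) w z +
      A ^ 2 * pairMoment μ U V (a + 0) (b + 1 + 0) w z)) at h1
    rw [e00, e01, e10, e11, e20, e21] at h1
    -- Adding `hsum` makes all coefficients nonnegative with sum `16`, which even gives `32 η`. The
    -- `32` in the statement is `2 * 48 / 3`, where `3` is the mass bound.
    have h3 : (t21 - 2 * t11 + t01) + (t20 - 2 * t10 + t00) ≤ 48 * η := by linarith
    have h4 := mul_le_mul_of_nonneg_left h3 (by positivity : 0 ≤ 2 * (N * A ^ 2 * B))
    have h5 := mul_le_mul_of_nonneg_left hs (by positivity : 0 ≤ 32 * η * A)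
    linarith
  · have h1 := pexp_sq_deviation μ (linForm V z) (linForm U w) (b + 1) a β α
    have h2 := hnn (-α) β (linForm V z - C β)
      (totalDegree_sub_le_of_le (dv z) (totalDegree_C_le β 1))
    have g1 : ∀ γ : ℝ, linForm V z ^ (b + 1) * linForm U w ^ a * (linForm V z + C β) *
        (linForm U w + C γ) * (linForm V z - C β) = linForm U w ^ a * linForm V z ^ (b + 1) *
        (linForm U w + C γ) * (linForm V z + C β) * (linForm V z - C β) := fun γ => by ring
    rw [hα, hβ, g1, g1] at h1
    change _ = 2 * (pairMoment μ V U (b + 1 + 2) (a + 1) z w -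
      2 * B * pairMoment μ V U (b + 1 + 1) (a + 1) z w +
      B ^ 2 * pairMoment μ V U (b + 1 + 0) (a + 1) z w +
      A * (pairMoment μ V U (b + 1 + 2) (a + 0) z w -
      2 * B * pairMoment μ V U (b + 1 + 1) (a + 0) z w +
      B ^ 2 * pairMoment μ V U (b + 1 + 0) (a + 0) z w)) at h1
    simp only [pairMoment_swap (U := U) (V := V)] at h1
    rw [e00, e01, e10, e11, e02, e12] at h1
    have h3 : (t12 - 2 * t11 + t10) + (t02 - 2 * t01 + t00) ≤ 48 * η := by linarith
    have h4 := mul_le_mul_of_nonneg_left h3 (by positivity : 0 ≤ 2 * (N * A * B ^ 2))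
    have h5 := mul_le_mul_of_nonneg_left hs (by positivity : 0 ≤ 32 * η * B)
    linarith
  · intro e hze
    have hE : 0 ≤ ∑ i, e i ^ 2 := Finset.sum_nonneg fun i _ => _root_.sq_nonneg _
    have ho := h.pexp_orthogonal_le hB (by omega) hz (fun z' hz' => hmax w z' hw hz') hze
    have hGle : t00 + 2 * t01 + t02 + 2 * t10 + 4 * t11 + 2 * t12 + t20 + 2 * t21 + t22 ≤
      16 * (1 + η) := by linarith
    have hexp := pexp_sq_weight μ (linForm U w) (linForm V z) (linForm V e) a b A B
    have hsg := pexp_sq_signs μ (linForm U w) (linForm V z) (linForm V e) a (b + 1) α β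
    rw [hα, hβ] at hsg
    have hR : ∀ i j, i ≤ 2 → j ≤ 2 →
        0 ≤ pexp μ ((linForm U w ^ (a + i) * linForm V z ^ (b + j) * linForm V e) ^ 2) := by
      intro i j hi hj
      refine h.sq_nonneg _ ?_
      have := totalDegree_mul_le_of_le (h.totalDegree_monomial (a + i) (b + j) w z) (dv e)
      omega
    -- The second-order condition has lost one power of `y`. Comparing coefficients, its weight
    -- still dominates `A` times the sign average of `s ^ 2`.
    have hWA : A * (pexp μ ((linForm U w ^ (a + 1) * linForm V z ^ (b + 1 + 1) * linForm V e) ^ 2) +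
        B * pexp μ ((linForm U w ^ (a + 1) * linForm V z ^ (b + 1) * linForm V e) ^ 2) +
        A * pexp μ ((linForm U w ^ a * linForm V z ^ (b + 1 + 1) * linForm V e) ^ 2) +
        A * B * pexp μ ((linForm U w ^ a * linForm V z ^ (b + 1) * linForm V e) ^ 2)) ≤
        pexp μ ((linForm U w ^ a * linForm V z ^ b * (linForm U w ^ 2 + C A) *
          (linForm V z ^ 2 + C B) * linForm V e) ^ 2) := by
      rw [hexp, show b + 1 + 1 = b + 2 from rfl]
      have r00 := mul_nonneg (by positivity : 0 ≤ A ^ 2 * B ^ 2) (hR 0 0 (by omega) (by omega))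
      have r01 := mul_nonneg (by positivity : 0 ≤ A ^ 2 * B) (hR 0 1 (by omega) (by omega))
      have r10 := mul_nonneg (by positivity : 0 ≤ 2 * A * B ^ 2) (hR 1 0 (by omega) (by omega))
      have r11 := mul_nonneg (by positivity : 0 ≤ 3 * A * B) (hR 1 1 (by omega) (by omega))
      have r12 := mul_nonneg hA.le (hR 1 2 (by omega) (by omega))
      have r20 := mul_nonneg (by positivity : 0 ≤ B ^ 2) (hR 2 0 (by omega) (by omega))
      have r21 := mul_nonneg (by positivity : 0 ≤ 2 * B) (hR 2 1 (by omega) (by omega))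
      have r22 := hR 2 2 (by omega) (by omega)
      simp only [add_zero] at r00 r01 r10 r20
      linarith
    have n1 := hnn α (-β) _ (dv e)
    have n2 := hnn (-α) β _ (dv e)
    have n3 := hnn (-α) (-β) _ (dv e)
    have hb : (0 : ℝ) < b + 1 := by positivity
    have k1 : A * pexp μ ((s * linForm V e) ^ 2) ≤ 4 * pexp μ ((linForm U w ^ a * linForm V z ^ b *
        (linForm U w ^ 2 + C A) * (linForm V z ^ 2 + C B) * linForm V e) ^ 2) := by
      refine le_trans ?_ (mul_le_mul_of_nonneg_left hWA (by norm_num : (0 : ℝ) ≤ 4))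
      rw [mul_left_comm, ← hsg]
      refine mul_le_mul_of_nonneg_left ?_ hA.le
      linarith
    -- The constant is `4 * 3 * 16 (1 + η) / 3 = 64 (1 + η) ≤ 65`.
    have k2 : (b + 1) * (A * pexp μ ((s * linForm V e) ^ 2)) ≤
        A * (65 * B * (∑ i, e i ^ 2) * pexp μ (s ^ 2)) := by
      calc _ ≤ (b + 1) * (4 * pexp μ ((linForm U w ^ a * linForm V z ^ b *
        (linForm U w ^ 2 + C A) * (linForm V z ^ 2 + C B) * linForm V e) ^ 2)) :=
            mul_le_mul_of_nonneg_left k1 hb.le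
        _ ≤ 4 * (3 * (∑ i, e i ^ 2) * (N * A ^ 2 * B ^ 2 * (16 * (1 + η)))) := by
            rw [hG] at ho
            have h7 := mul_le_mul_of_nonneg_left hGle
              (mul_nonneg (mul_nonneg (by norm_num : (0 : ℝ) ≤ 3) hE) hNAB.le)
            linarith
        _ = A * (64 * (1 + η) * B * (∑ i, e i ^ 2) * (3 * (N * A * B))) := by ring
        _ ≤ A * (65 * B * (∑ i, e i ^ 2) * pexp μ (s ^ 2)) := by
            refine mul_le_mul_of_nonneg_left ?_ hA.le
            refine mul_le_mul ?_ hs (by positivity) (by positivity)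
            refine mul_le_mul_of_nonneg_right ?_ hE
            refine mul_le_mul_of_nonneg_right ?_ hB.le
            linarith
    refine le_of_mul_le_mul_left ?_ (mul_pos hb hA)
    calc _ = (b + 1) * (A * pexp μ ((s * linForm V e) ^ 2)) := by ring
      _ ≤ _ := k2
      _ = _ := by field_simp

end IsSpherePair

/-! ### From concentration to small covariance. -/

section Covariance

variable {σ : Type} {n : ℕ} {ν : SignedFn σ}

/-- The pseudo-variance is nonnegative. -/
theorem sq_pexp_le (h1 : pexp ν 1 = 1)
    (hsq : ∀ f : MvPolynomial σ ℝ, f.totalDegree ≤ 1 → 0 ≤ pexp ν (f ^ 2))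
    {f : MvPolynomial σ ℝ} (hf : f.totalDegree ≤ 1) : pexp ν f ^ 2 ≤ pexp ν (f ^ 2) := by
  have h := hsq (f - C (pexp ν f)) (totalDegree_sub_le_of_le hf (totalDegree_C_le _ 1))
  have e : (f - C (pexp ν f)) ^ 2 = f ^ 2 - C (2 * pexp ν f) * f + C (pexp ν f ^ 2) * 1 := by
    simp only [C_mul, C_pow, map_ofNat]; ring
  rw [e, pexp_add, pexp_sub, pexp_C_mul, pexp_C_mul, h1] at h
  linarith

theorem pexp_linForm (U : Fin n → MvPolynomial σ ℝ) (w : Fin n → ℝ) :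
    pexp ν (linForm U w) = ∑ i, w i * pexp ν (U i) := by
  simp only [linForm, pexp_sum, pexp_C_mul]

/-- The mean of `⟨u,w⟩` is within `|α|/2` of `α`, so the mean vector has length at least `|α|/2`. -/
theorem sq_div_four_le_sum_mean_sq (h1 : pexp ν 1 = 1)
    (hsq : ∀ f : MvPolynomial σ ℝ, f.totalDegree ≤ 1 → 0 ≤ pexp ν (f ^ 2))
    {U : Fin n → MvPolynomial σ ℝ} (hU : ∀ i, (U i).totalDegree ≤ 1) {w : Fin n → ℝ}
    (hw : ∑ i, w i ^ 2 = 1) {α : ℝ} (hα : pexp ν ((linForm U w - C α) ^ 2) ≤ α ^ 2 / 4) :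
    α ^ 2 / 4 ≤ ∑ i, pexp ν (U i) ^ 2 := by
  have h2 := (sq_pexp_le h1 hsq (totalDegree_sub_le_of_le (totalDegree_linForm hU w)
    (totalDegree_C_le α 1))).trans hα
  have e : pexp ν (C α) = α := by rw [← mul_one (C α), pexp_C_mul, h1, mul_one]
  rw [pexp_sub, e] at h2
  have hcs := Finset.sum_mul_sq_le_sq_mul_sq Finset.univ w (fun i => pexp ν (U i))
  rw [← pexp_linForm, hw, one_mul] at hcs
  nlinarith [sq_nonneg (α + 2 * (pexp ν (linForm U w) - α))]

/-- If `v` has small second moments around some point, in every direction, then the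
covariance of `u` and `v` is small in Frobenius norm. -/
theorem sum_covariance_sq_le (h1 : pexp ν 1 = 1)
    (hsq : ∀ f : MvPolynomial σ ℝ, f.totalDegree ≤ 1 → 0 ≤ pexp ν (f ^ 2))
    {U V : Fin n → MvPolynomial σ ℝ} (hU : ∀ i, (U i).totalDegree ≤ 1)
    (hV : ∀ i, (V i).totalDegree ≤ 1) (hnorm : pexp ν (∑ i, U i ^ 2) = 1) {κ : ℝ} (hκ : 0 < κ)
    (m : Fin n → ℝ)
    (hvar : ∀ c : Fin n → ℝ, pexp ν ((linForm V c - C (∑ j, c j * m j)) ^ 2) ≤ κ * ∑ j, c j ^ 2) :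
    ∑ i, ∑ j, (pexp ν (U i * V j) - pexp ν (U i) * pexp ν (V j)) ^ 2 ≤ κ := by
  set K : Fin n → Fin n → ℝ := fun i j => pexp ν (U i * V j) - pexp ν (U i) * pexp ν (V j) with hK
  have hC : ∀ c : ℝ, pexp ν (C c) = c := fun c => by
    rw [← mul_one (C c), pexp_C_mul, h1, mul_one]
  set f : Fin n → MvPolynomial σ ℝ := fun i => U i - C (pexp ν (U i)) with hf
  -- Row `K i` of the covariance serves as test direction for `v`. As `f i` is centred, `Ẽ (f i * g
  -- i)` is `‖K i‖²` whatever `m` is.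
  set g : Fin n → MvPolynomial σ ℝ := fun i => linForm V (K i) - C (∑ j, K i j * m j) with hg
  have hfg : ∀ i, pexp ν (f i * g i) = ∑ j, K i j ^ 2 := by
    intro i
    have e : f i * g i = (∑ j, C (K i j) * (U i * V j)) - C (∑ j, K i j * m j) * U i -
        C (pexp ν (U i)) * linForm V (K i) + C (pexp ν (U i) * ∑ j, K i j * m j) := by
      have : ∑ j, C (K i j) * (U i * V j) = U i * linForm V (K i) := by
        rw [linForm, Finset.mul_sum]
        exact Finset.sum_congr rfl fun j _ => by ring
      rw [this, C_mul]
      simp only [hf, hg]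
      ring
    rw [e, pexp_add, pexp_sub, pexp_sub, pexp_sum, hC, pexp_C_mul, pexp_C_mul, pexp_linForm]
    simp only [pexp_C_mul]
    have e2 : ∑ j, K i j ^ 2 = ∑ j, K i j * pexp ν (U i * V j) -
        pexp ν (U i) * ∑ j, K i j * pexp ν (V j) := by
      rw [Finset.mul_sum, ← Finset.sum_sub_distrib]
      refine Finset.sum_congr rfl fun j _ => ?_
      simp only [hK]; ring
    rw [e2]; ring
  -- This is `2 κ f g ≤ κ² f² + g²`; in the sum over `i` the variances of the `u_i` add up to at
  -- most `1`.
  have hamgm : ∀ i, 2 * κ * ∑ j, K i j ^ 2 ≤ κ ^ 2 * pexp ν (f i ^ 2) + κ * ∑ j, K i j ^ 2 := by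
    intro i
    have df : (f i).totalDegree ≤ 1 := totalDegree_sub_le_of_le (hU i) (totalDegree_C_le _ 1)
    have dg : (g i).totalDegree ≤ 1 :=
      totalDegree_sub_le_of_le (totalDegree_linForm hV _) (totalDegree_C_le _ 1)
    have h2 := hsq (C κ * f i - g i) (totalDegree_sub_le_of_le
      (by simpa using totalDegree_mul_le_of_le (totalDegree_C_le κ 0) df) dg)
    have e : (C κ * f i - g i) ^ 2 = C (κ ^ 2) * f i ^ 2 - C (2 * κ) * (f i * g i) + g i ^ 2 := by
      simp only [C_mul, C_pow, map_ofNat]; ring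
    rw [e, pexp_add, pexp_sub, pexp_C_mul, pexp_C_mul, hfg] at h2
    have h3 := hvar (K i)
    linarith
  have hsum := Finset.sum_le_sum fun i (_ : i ∈ Finset.univ) => hamgm i
  rw [Finset.sum_add_distrib, ← Finset.mul_sum, ← Finset.mul_sum, ← Finset.mul_sum] at hsum
  have hvarU : ∑ i, pexp ν (f i ^ 2) ≤ 1 := by
    rw [← hnorm, pexp_sum]
    refine Finset.sum_le_sum fun i _ => ?_
    have e : f i ^ 2 = U i ^ 2 - C (2 * pexp ν (U i)) * U i + C (pexp ν (U i) ^ 2) := by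
      simp only [hf, C_mul, C_pow, map_ofNat]; ring
    rw [e, pexp_add, pexp_sub, pexp_C_mul, hC]
    nlinarith [sq_nonneg (pexp ν (U i))]
  have h5 : κ * ∑ i, ∑ j, K i j ^ 2 ≤ κ * κ := by
    have := mul_le_mul_of_nonneg_left hvarU (sq_nonneg κ)
    linarith
  exact le_of_mul_le_mul_left h5 hκ

end Covariance

namespace IsSpherePair

variable {σ : Type} {n d : ℕ} {μ : SignedFn σ} {U V : Fin n → MvPolynomial σ ℝ}

/-- A reweighting after which the covariance of `u` and `v` is small. -/
theorem exists_reweighting (h : IsSpherePair d μ U V) (hn : 0 < n) {J : ℕ} (hJ : 2 ≤ J)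
    (hd : 16 * J + 2 ≤ d) {ε : ℝ} (hlog : Real.log n / J ≤ 1 / 400)
    (hε : 32 * (64 * Real.log n + 65) * (n + J) ≤ ε ^ 2 * J ^ 2) :
    ∃ p : MvPolynomial σ ℝ, IsReweightingPoly (16 * J) μ p ∧
      0 < ∑ i, pexp (reweight p μ) (U i) ^ 2 ∧ 0 < ∑ i, pexp (reweight p μ) (V i) ^ 2 ∧
      ∑ i, ∑ j, (pexp (reweight p μ) (U i * V j) -
          pexp (reweight p μ) (U i) * pexp (reweight p μ) (V j)) ^ 2 ≤
        ε ^ 2 * ((∑ i, pexp (reweight p μ) (U i) ^ 2) *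
          ∑ i, pexp (reweight p μ) (V i) ^ 2) := by
  have hJ0 : (0 : ℝ) < J := by exact_mod_cast (by omega : 0 < J)
  have hn1 : (1 : ℝ) ≤ n := by exact_mod_cast hn
  have hln : 0 ≤ Real.log n := Real.log_nonneg hn1
  obtain ⟨a, b, N, A, B, hbJ, hab, hN, hAJ, hB, hc, hup⟩ :=
    h.exists_geometric_maxMoment hn hJ (by omega)
  have hA : 0 < A := lt_of_lt_of_le (by positivity) hAJ
  obtain ⟨b, rfl⟩ : ∃ b', b = b' + 1 := ⟨b - 1, by omega⟩
  set η : ℝ := 2 * (Real.log n / J) with hη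
  have hη0 : 0 ≤ η := by positivity
  have hη1 : η ≤ 1 / 200 := by rw [hη]; linarith
  have hexp : Real.exp (Real.log n / J) ≤ 1 + η := by
    have ht : 0 ≤ Real.log n / J := by positivity
    have h1 := Real.abs_exp_sub_one_le (x := Real.log n / J) (by rw [abs_of_nonneg ht]; linarith)
    rw [abs_of_nonneg ht] at h1
    have h2 := le_abs_self (Real.exp (Real.log n / J) - 1)
    rw [hη]; linarith
  obtain ⟨w, z, α, β, s, hw, hz, hdeg, hα, hβ, hs, hx, hy, ho⟩ :=
    h.exists_concentrated_weight hn (a := a) (b := b) (by omega) hN hA hB hη0 hη1 hc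
      (fun i j hi hj => (hup i j hi hj).trans
        (mul_le_mul_of_nonneg_right hexp (by positivity)))
  set m := pexp μ (s ^ 2) with hm
  set p : MvPolynomial σ ℝ := C m⁻¹ * s ^ 2 with hp
  have hpe : ∀ f, pexp (reweight p μ) f = m⁻¹ * pexp μ (s ^ 2 * f) := fun f => by
    rw [pexp_reweight, hp, mul_assoc, pexp_C_mul]
  have hpsq : ∀ f, pexp (reweight p μ) (f ^ 2) = m⁻¹ * pexp μ ((s * f) ^ 2) := fun f => by
    rw [hpe, mul_pow]
  have hmi : 0 < m⁻¹ := inv_pos.mpr hs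
  have h1 : pexp (reweight p μ) 1 = 1 := by
    rw [hpe, mul_one, ← hm, inv_mul_cancel₀ hs.ne']
  have hsq : ∀ f : MvPolynomial σ ℝ, f.totalDegree ≤ 1 → 0 ≤ pexp (reweight p μ) (f ^ 2) := by
    intro f hf
    rw [hpsq]
    refine mul_nonneg hmi.le (h.sq_nonneg _ ?_)
    have := totalDegree_mul_le_of_le hdeg hf
    omega
  have hdeg2 : (s ^ 2).totalDegree ≤ 16 * J := by
    have := totalDegree_pow s 2
    omega
  have hnorm : pexp (reweight p μ) (∑ i, U i ^ 2) = 1 := by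
    rw [hpe, h.norm_left _ (by omega), ← hm, inv_mul_cancel₀ hs.ne']
  have hdiv : ∀ {f : MvPolynomial σ ℝ} {c : ℝ}, pexp μ ((s * f) ^ 2) ≤ c * m →
      pexp (reweight p μ) (f ^ 2) ≤ c := by
    intro f c hf
    rw [hpsq]
    have := mul_le_mul_of_nonneg_left hf hmi.le
    rwa [mul_left_comm, inv_mul_cancel₀ hs.ne', mul_one] at this
  have hx' := hdiv hx
  have hy' := hdiv hy
  have hu := sq_div_four_le_sum_mean_sq h1 hsq h.degree_left hw (α := α)
    (hx'.trans (by rw [hα]; nlinarith))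
  have hv := sq_div_four_le_sum_mean_sq h1 hsq h.degree_right hz (α := β)
    (hy'.trans (by rw [hβ]; nlinarith))
  rw [hα] at hu
  rw [hβ] at hv
  have hb0 : (0 : ℝ) < b + 1 := by positivity
  have hbJ' : (J : ℝ) ≤ b + 1 := by exact_mod_cast hbJ
  set τ : ℝ := 32 * η * B + 65 * B / (b + 1) with hτ
  have hτ0 : 0 < τ := by positivity
  have hvar : ∀ c : Fin n → ℝ, pexp (reweight p μ)
      ((linForm V c - C (∑ j, c j * (β * z j))) ^ 2) ≤ (2 * τ) * ∑ j, c j ^ 2 := by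
    intro c
    set r : ℝ := ∑ j, c j * z j with hr
    have hrβ : ∑ j, c j * (β * z j) = r * β := by
      rw [hr, Finset.sum_mul]; exact Finset.sum_congr rfl fun j _ => by ring
    have hperp : ∑ j, z j * (c + (-r) • z) j = 0 := by
      have : ∀ j, z j * (c + (-r) • z) j = c j * z j - r * z j ^ 2 := fun j => by
        simp only [Pi.add_apply, Pi.smul_apply, smul_eq_mul]; ring
      simp only [this, Finset.sum_sub_distrib, ← Finset.mul_sum, hz, ← hr]
      ring
    have hnrm : ∑ j, (c + (-r) • z) j ^ 2 = ∑ j, c j ^ 2 - r ^ 2 := by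
      have : ∀ j, (c + (-r) • z) j ^ 2 = c j ^ 2 - 2 * r * (c j * z j) + r ^ 2 * z j ^ 2 :=
        fun j => by simp only [Pi.add_apply, Pi.smul_apply, smul_eq_mul]; ring
      simp only [this, Finset.sum_add_distrib, Finset.sum_sub_distrib, ← Finset.mul_sum, hz, ← hr]
      ring
    have ho' := hdiv (ho _ hperp)
    have hnn : 0 ≤ ∑ j, (c + (-r) • z) j ^ 2 := Finset.sum_nonneg fun j _ => _root_.sq_nonneg _
    have hdz := totalDegree_mul_le_of_le (totalDegree_C_le (σ := σ) r 0)
      (totalDegree_sub_le_of_le (totalDegree_linForm h.degree_right z) (totalDegree_C_le β 1))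
    have hd1 := hsq (linForm V (c + (-r) • z) - C r * (linForm V z - C β))
      (totalDegree_sub_le_of_le (totalDegree_linForm h.degree_right _) (by simpa using hdz))
    -- The parallelogram identity for the parts of `c` orthogonal and parallel to `z`; it costs the
    -- factor `2` in `2 * τ`.
    have e : (linForm V c - C (r * β)) ^ 2 = C 2 * linForm V (c + (-r) • z) ^ 2 +
        C (2 * r ^ 2) * (linForm V z - C β) ^ 2 -
        (linForm V (c + (-r) • z) - C r * (linForm V z - C β)) ^ 2 := by
      rw [linForm_add, linForm_smul]
      simp only [C_mul, C_pow, C_neg, map_ofNat]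
      ring
    rw [hrβ, e, pexp_sub, pexp_add, pexp_C_mul, pexp_C_mul]
    have k1 : 65 * B / (b + 1) * ∑ j, (c + (-r) • z) j ^ 2 ≤ τ * ∑ j, (c + (-r) • z) j ^ 2 :=
      mul_le_mul_of_nonneg_right (by rw [hτ]; linarith [show 0 ≤ 32 * η * B by positivity]) hnn
    have k2 : r ^ 2 * pexp (reweight p μ) ((linForm V z - C β) ^ 2) ≤ r ^ 2 * τ :=
      mul_le_mul_of_nonneg_left (hy'.trans (by
        rw [hτ]; linarith [show 0 ≤ 65 * B / (b + 1) by positivity])) (_root_.sq_nonneg r)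
    rw [hnrm] at k1 ho'
    linarith
  have hcov := sum_covariance_sq_le h1 hsq h.degree_left h.degree_right hnorm
    (by positivity : 0 < 2 * τ) (fun j => β * z j) hvar
  have hu0 : 0 < ∑ i, pexp (reweight p μ) (U i) ^ 2 := lt_of_lt_of_le (by positivity) hu
  have hv0 : 0 < ∑ i, pexp (reweight p μ) (V i) ^ 2 := lt_of_lt_of_le (by positivity) hv
  refine ⟨p, ⟨?_, ?_, h1⟩, hu0, hv0, hcov.trans ?_⟩
  · have e : p = (C √m⁻¹ * s) * (C √m⁻¹ * s) := by
      rw [hp, mul_mul_mul_comm, ← C_mul, Real.mul_self_sqrt hmi.le, sq]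
    rw [e]
    exact IsSumSq.mul_self _
  · have := totalDegree_mul_le_of_le (totalDegree_C_le (σ := σ) m⁻¹ 0) hdeg2
    simpa using this
  · have hτle : τ ≤ B * ((64 * Real.log n + 65) / J) := by
      have : 65 * B / (b + 1) ≤ 65 * B / J := by gcongr
      rw [hτ, hη]
      refine (add_le_add_right this _).trans (le_of_eq ?_)
      ring
    -- Needed for `2 τ ≤ ε² (A / 4)(B / 4)`, whence `32 = 2 * 16`.
    have hA2 : 32 * ((64 * Real.log n + 65) / J) ≤ ε ^ 2 * A := by
      refine le_trans ?_ (mul_le_mul_of_nonneg_left hAJ (_root_.sq_nonneg ε))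
      rw [← mul_div_assoc, ← mul_div_assoc, div_le_div_iff₀ hJ0 (by positivity)]
      linarith
    have huv : A / 4 * (B / 4) ≤ (∑ i, pexp (reweight p μ) (U i) ^ 2) *
        ∑ i, pexp (reweight p μ) (V i) ^ 2 :=
      mul_le_mul hu hv (by positivity) hu0.le
    have k1 := mul_le_mul_of_nonneg_left huv (_root_.sq_nonneg ε)
    have k2 := mul_le_mul_of_nonneg_left hA2 hB.le
    linarith

end IsSpherePair

/-! ### The constraints on `(u, v)` and the choice of the degree. -/

section SphereConstraints

variable {n : ℕ}

theorem totalDegree_uVar (i : Fin n) : (uVar i : MvPolynomial (PairVar n) ℝ).totalDegree ≤ 1 := by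
  simp [uVar]

theorem totalDegree_vVar (i : Fin n) : (vVar i : MvPolynomial (PairVar n) ℝ).totalDegree ≤ 1 := by
  simp [vVar]

theorem pexp_mul_eq_of_satisfiesEq {σ : Type} {d : ℕ} {μ : SignedFn σ} {N : MvPolynomial σ ℝ}
    (hN : N.totalDegree ≤ 2) (h : SatisfiesEq d μ (N - 1)) (f : MvPolynomial σ ℝ)
    (hf : f.totalDegree + 2 ≤ d) : pexp μ (f * N) = pexp μ f := by
  have hdeg : (N - 1).totalDegree ≤ 2 := totalDegree_sub_le_of_le hN (by simp)
  have h0 := h f (by omega)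
  rw [sub_mul, one_mul, pexp_sub, mul_comm] at h0
  linarith

theorem totalDegree_sum_sq_le {σ : Type} {U : Fin n → MvPolynomial σ ℝ}
    (hU : ∀ i, (U i).totalDegree ≤ 1) : (∑ i, U i ^ 2).totalDegree ≤ 2 :=
  totalDegree_finsetSum_le fun i _ => totalDegree_pow_le_of_le (hU i) 2

theorem isSpherePair_of_isFeasible {d : ℕ} {μ : SignedFn (PairVar n)}
    (h : IsFeasible (sphereConstraints n) d μ) : IsSpherePair d μ uVar vVar where
  pexp_one := h.1.pexp_one
  sq_nonneg := h.1.pexp_sq_nonneg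
  degree_left := totalDegree_uVar
  degree_right := totalDegree_vVar
  norm_left := pexp_mul_eq_of_satisfiesEq (totalDegree_sum_sq_le totalDegree_uVar)
    (h.2 _ (Or.inl rfl))
  norm_right := pexp_mul_eq_of_satisfiesEq (totalDegree_sum_sq_le totalDegree_vVar)
    (h.2 _ (Or.inr rfl))

theorem pos_of_isFeasible {d : ℕ} {μ : SignedFn (PairVar n)} (hd : 2 ≤ d)
    (h : IsFeasible (sphereConstraints n) d μ) : 0 < n := by
  rcases Nat.eq_zero_or_pos n with rfl | hn
  · have h1 := (isSpherePair_of_isFeasible h).norm_left 1 (by simpa using hd)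
    simp [pexp_zero, h.1.pexp_one] at h1
  · exact hn

end SphereConstraints

section DegreeParam

/-- From `log (3 / e) ≥ 1 - e / 3`. A bound strictly above `1` lets a large power of the logarithm
absorb absolute constants. -/
theorem log_add_two_ge {n : ℕ} (hn : 0 < n) : (109 : ℝ) / 100 ≤ Real.log (n + 2) := by
  have h3 : Real.log 3 ≤ Real.log (n + 2) := by
    refine Real.log_le_log (by norm_num) ?_
    have : (1 : ℝ) ≤ n := by exact_mod_cast hn
    linarith
  have h1 := Real.one_sub_inv_le_log_of_pos (x := 3 / Real.exp 1) (by positivity)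
  rw [Real.log_div (by norm_num) (by positivity), Real.log_exp, inv_div] at h1
  have h2 := Real.exp_one_lt_d9
  linarith

/-- The degree parameter leaves enough room for the reweighting. -/
theorem exists_le_degreeParam {n : ℕ} (hn : 0 < n) {ε : ℝ} (hε : 0 < ε) :
    ∃ J : ℕ, 2 ≤ J ∧ 16 * J ≤ degreeParam 201 n ε ∧ Real.log n / J ≤ 1 / 400 ∧
      32 * (64 * Real.log n + 65) * (n + J) ≤ min ε 1 ^ 2 * J ^ 2 := by
  set e : ℝ := min ε 1 with he
  have he0 : 0 < e := lt_min hε one_pos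
  have he1 : e ≤ 1 := min_le_right _ _
  set ℓ : ℝ := Real.log (n + 2) with hℓ
  have hℓ1 : (109 : ℝ) / 100 ≤ ℓ := log_add_two_ge hn
  have hn1 : (1 : ℝ) ≤ n := by exact_mod_cast hn
  have hlog : Real.log n ≤ ℓ := Real.log_le_log (by linarith) (by linarith)
  have hs1 : 1 ≤ √(n : ℝ) := Real.one_le_sqrt.mpr hn1
  have hs2 : √(n : ℝ) ^ 2 = n := Real.sq_sqrt (by linarith)
  have he2 : 0 < e ^ 2 := by positivity
  have he2' : e ^ 2 ≤ 1 := pow_le_one₀ he0.le he1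
  set X : ℝ := √n * ℓ / e ^ 2 with hX
  have hXe : X * e ^ 2 = √n * ℓ := by rw [hX]; field_simp
  -- The origin of `C = 201`: one logarithm is needed, and the other `200` factors supply the
  -- constant.
  have hpow : (1000000 : ℝ) * ℓ ≤ ℓ ^ 201 := by
    rw [pow_succ]
    refine mul_le_mul_of_nonneg_right ?_ (by linarith)
    calc (1000000 : ℝ) ≤ (109 / 100) ^ 200 := by norm_num
      _ ≤ ℓ ^ 200 := pow_le_pow_left₀ (by norm_num) hℓ1 200
  have hk : 1000000 * X ≤ degreeParam 201 n ε := by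
    refine le_trans ?_ (Nat.le_ceil _)
    rw [hX, ← mul_div_assoc]
    refine div_le_div_of_nonneg_right ?_ he2.le
    have := mul_le_mul_of_nonneg_left hpow (by linarith : 0 ≤ √(n : ℝ))
    linarith
  have hXℓ : ℓ ≤ √n * ℓ := by nlinarith
  have hX0 : √n * ℓ ≤ X := by
    rw [hX, le_div_iff₀ he2]
    nlinarith
  set k := degreeParam 201 n ε with hkdef
  have hJk : (k : ℝ) ≤ 16 * ((k / 16 : ℕ) : ℝ) + 16 := by
    exact_mod_cast (by omega : k ≤ 16 * (k / 16) + 16)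
  set J := k / 16 with hJ
  have hJX : 60000 * X ≤ J := by linarith
  have hJ0 : (0 : ℝ) < J := by linarith
  have hln0 : 0 ≤ Real.log n := Real.log_nonneg hn1
  refine ⟨J, ?_, by omega, ?_, ?_⟩
  · have : (2 : ℝ) ≤ J := by linarith
    exact_mod_cast this
  · rw [div_le_iff₀ hJ0]
    linarith
  · have h1 : 32 * (64 * Real.log n + 65) ≤ 4128 * ℓ := by linarith
    have h2 : 60000 * (√n * ℓ) ≤ e ^ 2 * J := by
      have := mul_le_mul_of_nonneg_left hJX he2.le
      linarith
    have h3 : 60000 * ℓ ≤ e ^ 2 * J := by linarith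
    have h4 : 60000 * √n ≤ J := by nlinarith
    have h5 : 60000 * ℓ * J ≤ e ^ 2 * J * J := mul_le_mul_of_nonneg_right h3 hJ0.le
    have h6 : 60000 * (√n * ℓ) * (60000 * √n) ≤ e ^ 2 * J * J :=
      mul_le_mul h2 h4 (by positivity) (by positivity)
    have h7 : 60000 * (√n * ℓ) * (60000 * √n) = 3600000000 * (ℓ * n) := by
      linear_combination 3600000000 * ℓ * hs2
    have h8 := mul_le_mul_of_nonneg_right h1 (by positivity : 0 ≤ (n + J : ℝ))
    have h9 : 0 ≤ ℓ * n := by positivity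
    have h10 : 0 ≤ ℓ * J := by positivity
    nlinarith

end DegreeParam

section Norms

variable {n : ℕ}

theorem norm_toVec_sq (L : Matrix (Fin n) (Fin n) ℝ) :
    ‖toVec L‖ ^ 2 = ∑ i, ∑ j, L i j ^ 2 := by
  rw [EuclideanSpace.norm_sq_eq, Fintype.sum_prod_type]
  simp [toVec]

theorem norm_toVec_vecMulVec_sq (u v : Fin n → ℝ) :
    ‖toVec (Matrix.vecMulVec u v)‖ ^ 2 = (∑ i, u i ^ 2) * ∑ j, v j ^ 2 := by
  rw [norm_toVec_sq, Finset.sum_mul_sum]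
  simp [Matrix.vecMulVec_apply, mul_pow]

end Norms

/-- Every pseudo-distribution over pairs of unit vectors has a good reweighting. -/
theorem exists_good_reweighting {n : ℕ} {ε : ℝ} {μ : SignedFn (PairVar n)} (hε : 0 < ε)
    (h : IsFeasible (sphereConstraints n) (degreeParam 201 n ε + 2) μ) :
    ∃ p, IsReweightingPoly (degreeParam 201 n ε) μ p ∧
      Matrix.vecMulVec (meanU (reweight p μ)) (meanV (reweight p μ)) ≠ 0 ∧
      ‖toVec (meanUV (reweight p μ) -
          Matrix.vecMulVec (meanU (reweight p μ)) (meanV (reweight p μ)))‖ ≤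
        ε * ‖toVec (Matrix.vecMulVec (meanU (reweight p μ)) (meanV (reweight p μ)))‖ := by
  have hn := pos_of_isFeasible (by omega) h
  obtain ⟨J, hJ, hJk, hlog, hJε⟩ := exists_le_degreeParam hn hε
  obtain ⟨p, hp, hu, hv, hcov⟩ :=
    (isSpherePair_of_isFeasible h).exists_reweighting hn hJ (by omega) hlog hJε
  have hprod : ‖toVec (Matrix.vecMulVec (meanU (reweight p μ)) (meanV (reweight p μ)))‖ ^ 2 =
      (∑ i, pexp (reweight p μ) (uVar i) ^ 2) * ∑ i, pexp (reweight p μ) (vVar i) ^ 2 :=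
    norm_toVec_vecMulVec_sq _ _
  refine ⟨p, ⟨hp.isSumSq, hp.degree_le.trans hJk, hp.mass_one⟩, ?_, ?_⟩
  · intro h0
    rw [h0, norm_toVec_sq] at hprod
    simp only [Matrix.zero_apply, ne_eq, OfNat.ofNat_ne_zero, not_false_eq_true, zero_pow,
      Finset.sum_const_zero] at hprod
    exact (mul_pos hu hv).ne hprod
  · refine (sq_le_sq₀ (norm_nonneg _) (by positivity)).mp ?_
    rw [mul_pow, hprod, norm_toVec_sq]
    refine le_trans hcov ?_
    refine mul_le_mul_of_nonneg_right ?_ (by positivity)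
    exact pow_le_pow_left₀ (lt_min hε one_pos).le (min_le_left _ _) 2

/-! ### Feasibility, rounding and the algorithm. -/

section Rounding

variable {n : ℕ}

theorem totalDegree_subspaceConstraint (A : MatSpace n) :
    (∑ i : Fin n, ∑ j : Fin n, C (A (i, j)) * (uVar i * vVar j) :
      MvPolynomial (PairVar n) ℝ).totalDegree ≤ 2 := by
  refine totalDegree_finsetSum_le fun i _ => totalDegree_finsetSum_le fun j _ => ?_
  simpa using totalDegree_mul_le_of_le (totalDegree_C_le (A (i, j)) 0)
    (totalDegree_mul_le_of_le (totalDegree_uVar i) (totalDegree_vVar j))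

theorem inner_toVec (A : MatSpace n) (L : Matrix (Fin n) (Fin n) ℝ) :
    inner ℝ A (toVec L) = ∑ i, ∑ j, A (i, j) * L i j := by
  rw [PiLp.inner_apply, Fintype.sum_prod_type]
  simp [toVec, mul_comm]

/-- A reweighting preserves the constraint `u vᵀ ∈ W` in expectation. -/
theorem toVec_meanUV_mem {W : Submodule ℝ (MatSpace n)} {k : ℕ} {μ : SignedFn (PairVar n)}
    {p : MvPolynomial (PairVar n) ℝ} (hp : p.totalDegree ≤ k)
    (h : ∀ q ∈ subspaceConstraints W, SatisfiesEq (k + 2) μ q) :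
    toVec (meanUV (reweight p μ)) ∈ W := by
  rw [← Submodule.orthogonal_orthogonal W, Submodule.mem_orthogonal]
  intro A hA
  have hdeg := totalDegree_subspaceConstraint A
  -- The reweighting polynomial is itself the test polynomial; this is why `μ` needs degree `k + 2`.
  have h0 := h _ ⟨A, hA, rfl⟩ p (by omega)
  rw [inner_toVec, ← h0, mul_comm, Finset.mul_sum, pexp_sum]
  refine Finset.sum_congr rfl fun i _ => ?_
  rw [Finset.mul_sum, pexp_sum]
  refine Finset.sum_congr rfl fun j _ => ?_
  rw [meanUV, Matrix.of_apply, pexp_reweight, mul_left_comm p (C _), pexp_C_mul]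

/-- The point mass at a pair of unit vectors with `u vᵀ ∈ W` is feasible. -/
theorem exists_isFeasible {W : Submodule ℝ (MatSpace n)} {u v : Fin n → ℝ}
    (huv : Matrix.vecMulVec u v ≠ 0) (hW : toVec (Matrix.vecMulVec u v) ∈ W) (d : ℕ) :
    ∃ μ, IsFeasible (subspaceConstraints W ∪ sphereConstraints n) d μ := by
  classical
  have hu : 0 < ∑ i, u i ^ 2 := by
    refine (Finset.sum_nonneg fun i _ => sq_nonneg (u i)).lt_of_ne' fun h0 => huv ?_
    have hu0 : u = 0 := funext fun i => by
      simpa using (Finset.sum_eq_zero_iff_of_nonneg fun i _ => sq_nonneg (u i)).mp h0 i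
        (Finset.mem_univ i)
    rw [hu0, Matrix.zero_vecMulVec]
  have hv : 0 < ∑ i, v i ^ 2 := by
    refine (Finset.sum_nonneg fun i _ => sq_nonneg (v i)).lt_of_ne' fun h0 => huv ?_
    have hv0 : v = 0 := funext fun i => by
      simpa using (Finset.sum_eq_zero_iff_of_nonneg fun i _ => sq_nonneg (v i)).mp h0 i
        (Finset.mem_univ i)
    rw [hv0, Matrix.vecMulVec_zero]
  set r := √(∑ i, u i ^ 2) with hr
  set s := √(∑ i, v i ^ 2) with hs
  have hr0 : r ≠ 0 := (Real.sqrt_pos.mpr hu).ne'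
  have hs0 : s ≠ 0 := (Real.sqrt_pos.mpr hv).ne'
  have hr2 : r ^ 2 = ∑ i, u i ^ 2 := Real.sq_sqrt hu.le
  have hs2 : s ^ 2 = ∑ i, v i ^ 2 := Real.sq_sqrt hv.le
  set x : PairVar n → ℝ := Sum.elim (fun i => u i / r) (fun i => v i / s) with hx
  have he : ∀ f, pexp (Finsupp.single x 1) f = eval x f := fun f =>
    (Finsupp.sum_single_index (h := fun y c => c * eval y f) (zero_mul _)).trans (one_mul _)
  have hsat : ∀ q, eval x q = 0 → SatisfiesEq d (Finsupp.single x 1) q := fun q hq f _ => by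
    rw [he, map_mul, hq, zero_mul]
  refine ⟨Finsupp.single x 1, ⟨by rw [he, map_one], fun f _ => ?_⟩, ?_⟩
  · rw [he, map_pow]; positivity
  · rintro q (⟨A, hA, rfl⟩ | hq)
    · apply hsat
      have h0 := (Submodule.mem_orthogonal' W A).mp hA _ hW
      rw [inner_toVec] at h0
      have : eval x (∑ i : Fin n, ∑ j : Fin n, C (A (i, j)) * (uVar i * vVar j)) =
          (r * s)⁻¹ * ∑ i, ∑ j, A (i, j) * Matrix.vecMulVec u v i j := by
        simp only [map_sum, map_mul, eval_C, uVar, vVar, eval_X, hx, Sum.elim_inl, Sum.elim_inr,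
          Finset.mul_sum, Matrix.vecMulVec_apply]
        refine Finset.sum_congr rfl fun i _ => Finset.sum_congr rfl fun j _ => ?_
        field_simp
      rw [this, h0, mul_zero]
    · apply hsat
      rcases hq with rfl | hq
      · simp only [map_sub, map_sum, map_pow, uVar, eval_X, hx, Sum.elim_inl, map_one, div_pow,
          ← Finset.sum_div, hr2, div_self hu.ne', sub_self]
      · rw [Set.mem_singleton_iff] at hq
        subst hq
        simp only [map_sub, map_sum, map_pow, vVar, eval_X, hx, Sum.elim_inr, map_one, div_pow,
          ← Finset.sum_div, hs2, div_self hv.ne', sub_self]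

theorem rank_vecMulVec_eq_one {u v : Fin n → ℝ} (h : Matrix.vecMulVec u v ≠ 0) :
    (Matrix.vecMulVec u v).rank = 1 := by
  refine le_antisymm (Matrix.rank_vecMulVec_le u v) ?_
  rw [Nat.one_le_iff_ne_zero]
  intro h0
  rw [Matrix.rank, Submodule.finrank_eq_zero, LinearMap.range_eq_bot, ← Matrix.toLin'_apply',
    LinearEquiv.map_eq_zero_iff] at h0
  exact h h0

/-- A vector close to some vector of `W` has a large projection to `W`. -/
theorem norm_starProjection_sq_ge {E : Type*} [NormedAddCommGroup E] [InnerProductSpace ℝ E]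
    (W : Submodule ℝ E) [W.HasOrthogonalProjection] {L M : E} (hM : M ∈ W) {ε : ℝ}
    (h : ‖M - L‖ ≤ ε * ‖L‖) : (1 - ε ^ 2) * ‖L‖ ^ 2 ≤ ‖W.starProjection L‖ ^ 2 := by
  have h1 := Submodule.norm_sq_eq_add_norm_sq_starProjection L W
  have h2 : ‖Wᗮ.starProjection L‖ ≤ ‖M - L‖ := by
    have h3 : Wᗮ.starProjection M = 0 :=
      Submodule.starProjection_orthogonal_apply_eq_zero hM
    have h4 : Wᗮ.starProjection (L - M) = Wᗮ.starProjection L := by rw [map_sub, h3, sub_zero]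
    rw [← h4, norm_sub_rev M L]
    exact Submodule.norm_starProjection_apply_le _ _
  have h5 := pow_le_pow_left₀ (norm_nonneg _) (h2.trans h) 2
  rw [mul_pow] at h5
  linarith

end Rounding

theorem theorem4p2 :
    ∃ C : ℕ, 1 ≤ C ∧ ∃ proc : ReweightingProcedure, proc.Correct C ∧
      ∀ sos : SosSolver, sos.Correct →
        ∀ (n m : ℕ) (ε : ℝ) (W : Submodule ℝ (MatSpace n)) (b : Module.Basis (Fin m) ℝ W),
          0 < ε →
          (∃ u v : Fin n → ℝ, Matrix.vecMulVec u v ≠ 0 ∧ toVec (Matrix.vecMulVec u v) ∈ W) →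
          ∃ L : Matrix (Fin n) (Fin n) ℝ,
            roundingAlgorithm C sos proc (fun i => (b i : MatSpace n)) ε = some L ∧
            L ≠ 0 ∧ L.rank = 1 ∧
            (1 - ε ^ 2) * ‖toVec L‖ ^ 2 ≤ ‖W.starProjection (toVec L)‖ ^ 2 := by
  classical
  -- The procedure picks a good polynomial by choice, as a function of `n`, `ε` and `μ` alone; the
  -- value `0` is irrelevant.
  refine ⟨201, by norm_num, fun n ε μ =>
    if h : 0 < ε ∧ IsFeasible (sphereConstraints n) (degreeParam 201 n ε + 2) μ then
      (exists_good_reweighting h.1 h.2).choose else 0, ?_⟩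
  have hcorrect : ReweightingProcedure.Correct 201 fun n ε μ =>
      if h : 0 < ε ∧ IsFeasible (sphereConstraints n) (degreeParam 201 n ε + 2) μ then
        (exists_good_reweighting h.1 h.2).choose else 0 := by
    intro n ε μ hε hμ
    simp only [dif_pos (And.intro hε hμ)]
    exact (exists_good_reweighting hε hμ).choose_spec
  refine ⟨hcorrect, fun sos hsos n m ε W b hε hW => ?_⟩
  -- From here on only the correctness of the procedure matters.
  generalize (fun n ε μ =>
      if h : 0 < ε ∧ IsFeasible (sphereConstraints n) (degreeParam 201 n ε + 2) μ then
        (exists_good_reweighting h.1 h.2).choose else 0 : ReweightingProcedure) = proc at hcorrect ⊢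
  obtain ⟨u, v, huv, huvW⟩ := hW
  have hspan : Submodule.span ℝ (Set.range fun i => (b i : MatSpace n)) = W := by
    have h1 := congrArg (Submodule.map W.subtype) b.span_eq
    rw [Submodule.map_span, ← Set.range_comp, Submodule.map_top, Submodule.range_subtype] at h1
    exact h1
  unfold roundingAlgorithm
  rw [hspan]
  obtain ⟨hsome, hnone⟩ := hsos n (subspaceConstraints W ∪ sphereConstraints n)
    (degreeParam 201 n ε + 2)
  rcases hres : sos n (subspaceConstraints W ∪ sphereConstraints n)
    (degreeParam 201 n ε + 2) with _ | μ
  · exact absurd (exists_isFeasible huv huvW _) (hnone hres)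
  · have hfeas := hsome μ hres
    obtain ⟨hp, hne, hle⟩ := hcorrect n ε μ hε ⟨hfeas.1, fun q hq => hfeas.2 q (Or.inr hq)⟩
    refine ⟨_, rfl, hne, rank_vecMulVec_eq_one hne, ?_⟩
    refine norm_starProjection_sq_ge W (toVec_meanUV_mem hp.degree_le
      fun q hq => hfeas.2 q (Or.inl hq)) ?_
    exact hle
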